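/- **Setting.** Fix $p,q\in[0,1]$ and $\mathcal P_x\ge 0$. Write $\mathcal{CN}(0,s)$ for the circularly symmetric complex Gaussian law of variance $s$. For each $n$ let $$\mathbf y=\mathbf A\mathbf U\mathbf v+\mathbf z,\qquad \mathbf v=\mathbf X\mathbf b,\quad \mathbf X=\mathrm{diag}(\mathbf x),$$ where $\mathbf x\in\mathbb C^n$ has iid $\mathcal{CN}(0,\mathcal P_x)$ entries, $\mathbf b\in\{0,1\}^n$ has iid Bernoulli-$q$ entries, $\mathbf A$ is an $n\times n$ diagonal matrix with iid Bernoulli-$p$ diagonal entries, $\mathbf z\in\mathbb C^n$ has iid $\mathcal{CN}(0,1)$ entries, $\mathbf U$ is an $n\times n$ complex random matrix, and $\mathbf A,\mathbf U,\mathbf x,\mathbf b,\mathbf z$ are mutually independent. Let $\mathbf R=\mathbf U^\dagger\mathbf A^\dagger\mathbf A\mathbf U$ and suppose that $\mathbf R$ has a limiting spectrum, the law of a nonnegative random variable $|\mathsf R|^2$ of finite mean: as $n\to\infty$ the expected empirical eigenvalue distribution of $\mathbf R$ converges weakly to the law of $|\mathsf R|^2$, and $\frac1n\mathbb E[\mathrm{tr}\,\mathbf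 R]\to\mathbb E[|\mathsf R|^2]$. Let $\mathcal V_{\mathbf R}(s)=\mathbb E[\log(1+s|\mathsf R|^2)]$ be its Shannon transform (natural logarithms and nats throughout), and let $$\mathcal I_1=\limsup_{n\to\infty}\frac1n I(\mathbf v;\mathbf y\mid\mathbf A,\mathbf U),$$ which is $\lim_{n\to\infty}\frac1n I(\mathbf v;\mathbf y\mid\mathbf A,\mathbf U)$ whenever that limit exists. **Theorem.** Let $B_0\sim$ Bernoulli-$q$, $X_0\sim\mathcal{CN}(0,\mathcal P_x)$ and $Z\sim\mathcal{CN}(0,1)$ be independent, and let $V_0=X_0B_0$. Then $$\mathcal I_1\le\mathcal V_{\mathbf R}(q\,\mathcal P_x)\qquad\text{and}\qquad \mathcal I_1\le I\!\left(V_0;\ \sqrt{\mathbb E[|\mathsf R|^2]}\;V_0+Z\right).$$ -/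

import Mathlib

open MeasureTheory ProbabilityTheory Filter Topology InformationTheory
open scoped ENNReal NNReal Matrix unitInterval BoundedContinuousFunction

noncomputable section

namespace SupportRecovery

/-- Matrices carry the product (entrywise) Borel σ-algebra. -/
instance matrixMeasurableSpace (n : ℕ) : MeasurableSpace (Matrix (Fin n) (Fin n) ℂ) :=
  inferInstanceAs (MeasurableSpace (Fin n → Fin n → ℂ))

/-- The circularly symmetric complex Gaussian law `𝒞𝒩(0, s)`: real and imaginary part are
independent real centred Gaussians, each of variance `s / 2`. -/
def complexGaussian (s : ℝ≥0) : Measure ℂ :=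
  ((gaussianReal 0 (s / 2)).prod (gaussianReal 0 (s / 2))).map
    fun t : ℝ × ℝ => (t.1 : ℂ) + (t.2 : ℂ) * Complex.I

section Information

variable {Ω α β γ : Type*} [MeasurableSpace Ω] [MeasurableSpace α] [MeasurableSpace β]
  [MeasurableSpace γ]

/-- The mutual information (in nats) of the two coordinates under a joint law `ρ`: the divergence
of `ρ` from the product of its marginals. -/
def mutualInfoOfLaw (ρ : Measure (α × β)) : ℝ≥0∞ := klDiv ρ (ρ.fst.prod ρ.snd)

/-- The mutual information `I(X; Y)`. -/
def mutualInfo (X : Ω → α) (Y : Ω → β) (P : Measure Ω) : ℝ≥0∞ :=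
  mutualInfoOfLaw (P.map fun ω => (X ω, Y ω))

/-- The conditional mutual information `I(X; Y | W)`: the mutual information under the regular
conditional joint law of `(X, Y)` given `W = w`, averaged over the law of `W`. -/
def condMutualInfo [StandardBorelSpace α] [StandardBorelSpace β] [Nonempty α] [Nonempty β]
    (X : Ω → α) (Y : Ω → β) (W : Ω → γ) (P : Measure Ω) [IsFiniteMeasure P] : ℝ≥0∞ :=
  ∫⁻ w, mutualInfoOfLaw (condDistrib (fun ω => (X ω, Y ω)) W P w) ∂(P.map W)

end Information

section Model

variable {n : ℕ}

/-- The diagonal sampling matrix `A`, with diagonal `a`. -/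
def samplingMatrix (a : Fin n → ℂ) : Matrix (Fin n) (Fin n) ℂ := Matrix.diagonal a

/-- The signal `v = X b`, where `X = diag(x)`. -/
def signal (x b : Fin n → ℂ) : Fin n → ℂ := Matrix.diagonal x *ᵥ b

/-- The observation `y = A U v + z`. -/
def observation (a : Fin n → ℂ) (U : Matrix (Fin n) (Fin n) ℂ) (x b z : Fin n → ℂ) :
    Fin n → ℂ :=
  (samplingMatrix a * U) *ᵥ signal x b + z

/-- The matrix `R = Uᴴ Aᴴ A U`. -/
def gramMatrix (a : Fin n → ℂ) (U : Matrix (Fin n) (Fin n) ℂ) : Matrix (Fin n) (Fin n) ℂ :=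
  Uᴴ * (samplingMatrix a)ᴴ * samplingMatrix a * U

lemma gramMatrix_isHermitian (a : Fin n → ℂ) (U : Matrix (Fin n) (Fin n) ℂ) :
    (gramMatrix a U).IsHermitian := by
  simp [gramMatrix, Matrix.IsHermitian, Matrix.mul_assoc]

/-- The random objects of the model in dimension `n`: the diagonal entries `a` of `A` are iid
Bernoulli-`p`, the entries of `x` are iid `𝒞𝒩(0, Px)`, the entries of `b` are iid Bernoulli-`q`, the
entries of `z` are iid `𝒞𝒩(0, 1)`, `U` is a random matrix with an arbitrary law, and `a`, `U`, `x`,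
`b`, `z` are mutually independent (their joint law is the product of their laws). -/
structure IsObservationModel {Ω : Type*} [MeasurableSpace Ω] (P : Measure Ω)
    (p q : I) (Px : ℝ≥0) (a x b z : Ω → Fin n → ℂ) (U : Ω → Matrix (Fin n) (Fin n) ℂ) :
    Prop where
  law_a : HasLaw a (Measure.pi fun _ => bernoulliMeasure (1 : ℂ) 0 p) P
  law_x : HasLaw x (Measure.pi fun _ => complexGaussian Px) P
  law_b : HasLaw b (Measure.pi fun _ => bernoulliMeasure (1 : ℂ) 0 q) P
  law_z : HasLaw z (Measure.pi fun _ => complexGaussian 1) P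
  aemeasurable_U : AEMeasurable U P
  indep : P.map (fun ω => (a ω, U ω, x ω, b ω, z ω)) =
    (P.map a).prod ((P.map U).prod ((P.map x).prod ((P.map b).prod (P.map z))))

/-- The expectation of the normalized linear eigenvalue statistic
`(1/n) ∑ i, f (λ i)` of the random matrix `R`; in other words, the integral of `f` against the
expected empirical spectral distribution of `R`. -/
def expectedSpectralStat {Ω : Type*} [MeasurableSpace Ω] (P : Measure Ω)
    (a : Ω → Fin n → ℂ) (U : Ω → Matrix (Fin n) (Fin n) ℂ) (f : ℝ → ℝ≥0∞) : ℝ≥0∞ :=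
  ∫⁻ ω, (∑ i, f ((gramMatrix_isHermitian (a ω) (U ω)).eigenvalues i)) / n ∂P

end Model

/-- `μ` is the limiting spectrum of the sequence of random matrices `R = Uᴴ Aᴴ A U`: the expected
empirical spectral distributions converge weakly to `μ`, and their means `E[tr R] / n` converge to
the mean of `μ`, which is finite. -/
structure IsLimitingSpectrum {Ω : ℕ → Type*} [∀ n, MeasurableSpace (Ω n)]
    (P : ∀ n, Measure (Ω n)) (a : ∀ n, Ω n → Fin n → ℂ)
    (U : ∀ n, Ω n → Matrix (Fin n) (Fin n) ℂ) (μ : Measure ℝ) : Prop where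
  isProbabilityMeasure : IsProbabilityMeasure μ
  weak : ∀ f : ℝ →ᵇ ℝ≥0,
    Tendsto (fun n => expectedSpectralStat (P n) (a n) (U n) fun t => (f t : ℝ≥0∞)) atTop
      (𝓝 (∫⁻ t, f t ∂μ))
  integrable : Integrable (fun t : ℝ => t) μ
  mean : Tendsto (fun n => expectedSpectralStat (P n) (a n) (U n) ENNReal.ofReal) atTop
    (𝓝 (ENNReal.ofReal (∫ t, t ∂μ)))

/-- The Shannon transform `E[log (1 + s T)]`, for `T` of law `μ`, of a law on `[0, ∞)`. -/
def shannonTransform (μ : Measure ℝ) (s : ℝ) : ℝ := ∫ t, Real.log (1 + s * t) ∂μ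

end SupportRecovery

end

namespace SupportRecovery

set_option linter.unusedSectionVars false

/-! ### Kullback-Leibler divergence: chain rule and data processing -/

section Divergence

variable {α β γ δ : Type*} [MeasurableSpace α] [MeasurableSpace β] [MeasurableSpace γ]
  [MeasurableSpace δ]

/-! Conditionally on the matrices, the problem is about a fixed channel `v ↦ H v + z` with `H = A
U`, `R = Hᴴ H`, and iid entries of `v` with mean zero and variance `s = q Px`. Each bound is proved
for fixed `H` in terms of the eigenvalues of `R` or the columns of `H`, then averaged and passed to
the limit.

Both bounds rest on the identity `D(joint ‖ π ⊗ Q) = D(output ‖ Q) + I(input; output)`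
(`klDiv_noisyLaw_eq_add`). For `Q` a product of circular Gaussians its left side depends only on
second moments and is computed explicitly (`klDiv_noisyLaw_complexNoise`).

Shannon bound. Rotating the output by the eigenvectors of `H Hᴴ` preserves white noise and makes the
signal coordinates uncorrelated, with variances `s λ i`. Taking `Q` with variances `1 + s λ i` and
dropping the output divergence leaves `∑ log (1 + s λ i)` (`mutualInfoOfLaw_mulVec_le_sum_log`).
Since `log` is unbounded, weak convergence alone does not give the limit. The deficit `s t - log (1
+ s t)` is nonnegative and continuous, so its truncations are test functions, and convergence of the
means controls the linear part (`limsup_expectedSpectralStat_log_le`).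

Matched filter bound. The information about `v` is at most the sum over columns of the information
each entry would convey if sent alone (`mutualInfoOfLaw_noisyLaw_sum_le`), and a single entry sees a
scalar channel whose gain is the squared norm of its column (`vectorLaw_eq_scalar`). These gains add
up to `tr R`. Since `f s = I(V; √s V + Z)` is concave, it lies below an affine function that touches
it at the mean of the spectrum (`exists_scalarInfo_le_affine`), so convergence of the means is
enough.

Concavity of `f` needs no differentiation. With `D s` the divergence of `√s V + Z` from `Z`, the
identity above reads `D s + f s = s E|V|²`. Three looks at `V` with gains `s, d, d` and
superadditivity of divergence from a product measure give `2 D (s + d) ≤ D (s + 2 d) + D s`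
(`scalarDiv_submodular`). Hence `f` has decreasing increments, and together with monotonicity this
makes it concave. -/

theorem klDiv_map_of_leftInverse (μ ν : Measure α) [IsFiniteMeasure μ] [IsFiniteMeasure ν]
    {g : α → β} {h : β → α} (hg : Measurable g) (hh : Measurable h)
    (hgh : Function.LeftInverse h g) : klDiv (μ.map g) (ν.map g) = klDiv μ ν := by
  refine le_antisymm (klDiv_map_le μ ν hg) ?_
  have key := klDiv_map_le (μ.map g) (ν.map g) hh
  rwa [Measure.map_map hh hg, Measure.map_map hh hg, hgh.comp_eq_id, Measure.map_id,
    Measure.map_id] at key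

theorem klDiv_prod_left (μ ν : Measure α) (κ : Measure β) [IsFiniteMeasure μ] [IsFiniteMeasure ν]
    [IsProbabilityMeasure κ] : klDiv (μ.prod κ) (ν.prod κ) = klDiv μ ν := by
  rw [← Measure.compProd_const, ← Measure.compProd_const, klDiv_compProd_left]

theorem klDiv_prod_right (μ ν : Measure α) (κ : Measure β) [IsFiniteMeasure μ] [IsFiniteMeasure ν]
    [IsProbabilityMeasure κ] : klDiv (κ.prod μ) (κ.prod ν) = klDiv μ ν := by
  rw [← klDiv_prod_left μ ν κ, ← klDiv_map_of_leftInverse (μ.prod κ) (ν.prod κ)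
    measurable_swap measurable_swap Prod.swap_leftInverse, Measure.prod_swap, Measure.prod_swap]

/-- Chain rule for the divergence from a product measure. -/
theorem klDiv_prod_eq_add_fst [StandardBorelSpace β] [Nonempty β] (ρ : Measure (α × β))
    [IsProbabilityMeasure ρ] (μ : Measure α) (Q : Measure β) [IsProbabilityMeasure μ]
    [IsProbabilityMeasure Q] :
    klDiv ρ (μ.prod Q) = klDiv ρ.fst μ + klDiv ρ (ρ.fst.prod Q) := by
  have key := klDiv_compProd_eq_add ρ.fst μ ρ.condKernel (Kernel.const α Q)
  rwa [Measure.compProd_const, Measure.compProd_const, ρ.disintegrate ρ.condKernel] at key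

theorem klDiv_prod_eq_add_snd [StandardBorelSpace α] [Nonempty α] (ρ : Measure (α × β))
    [IsProbabilityMeasure ρ] (μ : Measure α) (Q : Measure β) [IsProbabilityMeasure μ]
    [IsProbabilityMeasure Q] :
    klDiv ρ (μ.prod Q) = klDiv ρ.snd Q + klDiv ρ (μ.prod ρ.snd) := by
  have : IsProbabilityMeasure (ρ.map Prod.swap) :=
    Measure.isProbabilityMeasure_map measurable_swap.aemeasurable
  have key := klDiv_prod_eq_add_fst (ρ.map Prod.swap) Q μ
  have hsnd : (ρ.map Prod.swap).fst = ρ.snd := by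
    rw [Measure.fst, Measure.snd, Measure.map_map measurable_fst measurable_swap]; rfl
  rwa [hsnd, ← Measure.prod_swap (μ := μ) (ν := Q), ← Measure.prod_swap (μ := μ) (ν := ρ.snd),
    klDiv_map_of_leftInverse _ _ measurable_swap measurable_swap Prod.swap_leftInverse,
    klDiv_map_of_leftInverse _ _ measurable_swap measurable_swap Prod.swap_leftInverse] at key

/-- Superadditivity of the divergence from a product measure, in submodular form. -/
theorem klDiv_add_klDiv_le_of_prod [StandardBorelSpace γ] [Nonempty γ]
    (ρ : Measure ((α × β) × γ)) [IsProbabilityMeasure ρ] (N : Measure (α × β)) (N₃ : Measure γ)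
    [IsProbabilityMeasure N] [IsProbabilityMeasure N₃] :
    klDiv ρ.fst N + klDiv (ρ.map fun t => (t.1.1, t.2)) (N.fst.prod N₃) ≤
      klDiv ρ (N.prod N₃) + klDiv ρ.fst.fst N.fst := by
  have hm : Measurable fun t : (α × β) × γ => (t.1.1, t.2) := by fun_prop
  have : IsProbabilityMeasure (ρ.map fun t => (t.1.1, t.2)) :=
    Measure.isProbabilityMeasure_map hm.aemeasurable
  rw [klDiv_prod_eq_add_fst (ρ.map fun t => (t.1.1, t.2)), klDiv_prod_eq_add_fst ρ]
  have hfst : (ρ.map fun t => (t.1.1, t.2)).fst = ρ.fst.fst := by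
    rw [Measure.fst, Measure.fst, Measure.fst, Measure.map_map measurable_fst hm,
      Measure.map_map measurable_fst measurable_fst]; rfl
  have hprod : (ρ.fst.prod N₃).map (fun t => (t.1.1, t.2)) = ρ.fst.fst.prod N₃ := by
    have := Measure.map_prod_map ρ.fst N₃ (measurable_fst (α := α) (β := β)) measurable_id
    rw [Measure.map_id] at this
    exact this.symm
  -- After the chain rule the terms for the first pair and for the first coordinate cancel. What
  -- remains is data processing under forgetting the second coordinate.
  have key := klDiv_map_le ρ (ρ.fst.prod N₃) hm
  rw [hprod] at key
  rw [hfst, add_assoc, add_comm (klDiv ρ.fst.fst N.fst)]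
  gcongr

theorem mutualInfoOfLaw_map_le (ρ : Measure (α × β)) [IsProbabilityMeasure ρ] {f : α → γ}
    {g : β → δ} (hf : Measurable f) (hg : Measurable g) :
    mutualInfoOfLaw (ρ.map (Prod.map f g)) ≤ mutualInfoOfLaw ρ := by
  have key := klDiv_map_le ρ (ρ.fst.prod ρ.snd) (hf.prodMap hg)
  rw [← Measure.map_prod_map _ _ hf hg] at key
  rw [mutualInfoOfLaw, mutualInfoOfLaw]
  convert key using 3
  · rw [Measure.fst, Measure.fst, Measure.map_map measurable_fst (hf.prodMap hg),
      Measure.map_map hf measurable_fst]; rfl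
  · rw [Measure.snd, Measure.snd, Measure.map_map measurable_snd (hf.prodMap hg),
      Measure.map_map hg measurable_snd]; rfl

end Divergence

/-! ### Additive noise channels and superposition of inputs -/

section AdditiveNoise

variable {V W E F : Type*} [MeasurableSpace V] [MeasurableSpace W] [MeasurableSpace E]
  [MeasurableSpace F] [AddCommGroup E] [AddCommGroup F] [MeasurableAdd₂ E] [MeasurableAdd₂ F]

/-- The joint law of input and output of the channel `v ↦ g v + z`, for an input of law `π` and an
independent noise `z` of law `ν`. -/
noncomputable def noisyLaw (π : Measure V) (g : V → E) (ν : Measure E) : Measure (V × E) :=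
  (π.prod ν).map fun t => (t.1, g t.1 + t.2)

variable {π : Measure V} {ϖ : Measure W} {g : V → E} {ν : Measure E}
  [IsProbabilityMeasure π] [IsProbabilityMeasure ϖ] [IsProbabilityMeasure ν]

theorem measurable_noisyMap (hg : Measurable g) :
    Measurable fun t : V × E => (t.1, g t.1 + t.2) := by fun_prop

theorem isProbabilityMeasure_noisyLaw (hg : Measurable g) :
    IsProbabilityMeasure (noisyLaw π g ν) :=
  Measure.isProbabilityMeasure_map (measurable_noisyMap hg).aemeasurable

theorem lintegral_noisyLaw (hg : Measurable g) {f : V × E → ℝ≥0∞} (hf : Measurable f) :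
    ∫⁻ t, f t ∂noisyLaw π g ν = ∫⁻ v, ∫⁻ z, f (v, g v + z) ∂ν ∂π := by
  rw [noisyLaw, lintegral_map hf (measurable_noisyMap hg), lintegral_prod]
  exact (hf.comp (measurable_noisyMap hg)).aemeasurable

theorem fst_noisyLaw (hg : Measurable g) : (noisyLaw π g ν).fst = π := by
  rw [noisyLaw, Measure.fst, Measure.map_map measurable_fst (measurable_noisyMap hg)]
  exact Measure.fst_prod

theorem mutualInfoOfLaw_noisyLaw (hg : Measurable g) : mutualInfoOfLaw (noisyLaw π g ν) =
    klDiv (noisyLaw π g ν) (π.prod (noisyLaw π g ν).snd) := by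
  rw [mutualInfoOfLaw, fst_noisyLaw hg]

/-- The divergence from `π ⊗ Q` splits into the mutual information and the divergence of the
output law from `Q`. -/
theorem klDiv_noisyLaw_eq_add [StandardBorelSpace V] [Nonempty V] (hg : Measurable g)
    (Q : Measure E) [IsProbabilityMeasure Q] : klDiv (noisyLaw π g ν) (π.prod Q) =
    klDiv (noisyLaw π g ν).snd Q + mutualInfoOfLaw (noisyLaw π g ν) := by
  have := isProbabilityMeasure_noisyLaw (π := π) (ν := ν) hg
  rw [mutualInfoOfLaw_noisyLaw hg, klDiv_prod_eq_add_snd]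

theorem noisyLaw_map_input {e : W → V} (he : Measurable e) (hg : Measurable g) :
    noisyLaw (ϖ.map e) g ν = (noisyLaw ϖ (g ∘ e) ν).map (Prod.map e id) := by
  have h := Measure.map_prod_map ϖ ν he measurable_id
  rw [Measure.map_id] at h
  rw [noisyLaw, noisyLaw, h, Measure.map_map (measurable_noisyMap hg) (he.prodMap measurable_id),
    Measure.map_map (he.prodMap measurable_id) (measurable_noisyMap (hg.comp he))]
  rfl

theorem mutualInfoOfLaw_noisyLaw_map_le {e : W → V} (he : Measurable e) (hg : Measurable g) :
    mutualInfoOfLaw (noisyLaw (ϖ.map e) g ν) ≤ mutualInfoOfLaw (noisyLaw ϖ (g ∘ e) ν) := by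
  have := isProbabilityMeasure_noisyLaw (π := ϖ) (ν := ν) (hg.comp he)
  rw [noisyLaw_map_input he hg]
  exact mutualInfoOfLaw_map_le _ he measurable_id

/-- Since `M` is additive, filtering the output gives again an additive noise channel, with filtered
signal and filtered noise; data processing then applies within this class. -/
theorem noisyLaw_map_output (M : E →+ F) (hM : Measurable M) (hg : Measurable g) :
    (noisyLaw π g ν).map (Prod.map id M) = noisyLaw π (M ∘ g) (ν.map M) := by
  have h := Measure.map_prod_map π ν measurable_id hM
  rw [Measure.map_id] at h
  rw [noisyLaw, noisyLaw, h, Measure.map_map (measurable_noisyMap (hM.comp hg))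
    (measurable_id.prodMap hM), Measure.map_map (measurable_id.prodMap hM)
    (measurable_noisyMap hg)]
  congr 1
  funext t
  simp

theorem snd_noisyLaw_map_output (M : E →+ F) (hM : Measurable M) (hg : Measurable g) :
    (noisyLaw π g ν).snd.map M = (noisyLaw π (M ∘ g) (ν.map M)).snd := by
  rw [← noisyLaw_map_output M hM hg, Measure.snd, Measure.snd, Measure.map_map hM measurable_snd,
    Measure.map_map measurable_snd (measurable_id.prodMap hM)]
  rfl

theorem mutualInfoOfLaw_noisyLaw_output_le (M : E →+ F) (hM : Measurable M) (hg : Measurable g) :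
    mutualInfoOfLaw (noisyLaw π (M ∘ g) (ν.map M)) ≤ mutualInfoOfLaw (noisyLaw π g ν) := by
  have := isProbabilityMeasure_noisyLaw (π := π) (ν := ν) hg
  rw [← noisyLaw_map_output M hM hg]
  exact mutualInfoOfLaw_map_le _ measurable_id hM

theorem mutualInfoOfLaw_noisyLaw_zero : mutualInfoOfLaw (noisyLaw π (fun _ => (0 : E)) ν) = 0 := by
  have h : noisyLaw π (fun _ => (0 : E)) ν = π.prod ν := by simp [noisyLaw]
  rw [mutualInfoOfLaw, h, Measure.fst_prod, Measure.snd_prod, klDiv_self]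

theorem snd_noisyLaw : (noisyLaw π g ν).snd = (noisyLaw π g ν).map Prod.snd := rfl

theorem lintegral_snd_noisyLaw (hg : Measurable g) {f : E → ℝ≥0∞} (hf : Measurable f) :
    ∫⁻ t, f t ∂(noisyLaw π g ν).snd = ∫⁻ v, ∫⁻ z, f (g v + z) ∂ν ∂π := by
  rw [snd_noisyLaw, lintegral_map hf measurable_snd, lintegral_noisyLaw hg (by fun_prop)]

/-- Independent inputs that are superposed inform about themselves at most as much as they would
separately. -/
theorem mutualInfoOfLaw_noisyLaw_add_le [MeasurableSub₂ E] [StandardBorelSpace W] [Nonempty W]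
    {h : W → E} (hg : Measurable g) (hh : Measurable h) :
    mutualInfoOfLaw (noisyLaw (π.prod ϖ) (fun v => g v.1 + h v.2) ν) ≤
      mutualInfoOfLaw (noisyLaw π g ν) + mutualInfoOfLaw (noisyLaw ϖ h ν) := by
  have hgh : Measurable fun v : V × W => g v.1 + h v.2 := by fun_prop
  have i0 := isProbabilityMeasure_noisyLaw (π := π.prod ϖ) (ν := ν) hgh
  have i1 := isProbabilityMeasure_noisyLaw (π := π) (ν := ν) hg
  have i2 := isProbabilityMeasure_noisyLaw (π := ϖ) (ν := ν) hh
  rw [mutualInfoOfLaw_noisyLaw hgh, mutualInfoOfLaw_noisyLaw hg, mutualInfoOfLaw_noisyLaw hh]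
  set ρ := noisyLaw (π.prod ϖ) (fun v => g v.1 + h v.2) ν with hρ
  have hs : Measurable fun t : (V × W) × E => (t.1.2, (t.1.1, t.2)) := by fun_prop
  have hs' : Measurable fun t : W × (V × E) => ((t.2.1, t.1), t.2.2) := by fun_prop
  set τ := ρ.map fun t => (t.1.2, (t.1.1, t.2)) with hτ
  have i3 : IsProbabilityMeasure τ := Measure.isProbabilityMeasure_map hs.aemeasurable
  have lρ : ∀ f : (V × W) × E → ℝ≥0∞, Measurable f → ∫⁻ t, f t ∂ρ =
      ∫⁻ v, ∫⁻ w, ∫⁻ z, f ((v, w), g v + h w + z) ∂ν ∂ϖ ∂π := by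
    intro f hf
    rw [hρ, lintegral_noisyLaw hgh hf, lintegral_prod]
    exact Measurable.aemeasurable (by fun_prop)
  have lτ : ∀ f : W × (V × E) → ℝ≥0∞, Measurable f → ∫⁻ t, f t ∂τ =
      ∫⁻ v, ∫⁻ w, ∫⁻ z, f (w, (v, g v + h w + z)) ∂ν ∂ϖ ∂π := by
    intro f hf
    rw [hτ, lintegral_map hf hs, lρ _ (by fun_prop)]
  have lτs : ∀ f : V × E → ℝ≥0∞, Measurable f → ∫⁻ t, f t ∂τ.snd =
      ∫⁻ v, ∫⁻ w, ∫⁻ z, f (v, g v + h w + z) ∂ν ∂ϖ ∂π := by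
    intro f hf
    rw [Measure.snd, lintegral_map hf measurable_snd, lτ _ (by fun_prop)]
  have lρs : ∀ f : E → ℝ≥0∞, Measurable f → ∫⁻ t, f t ∂ρ.snd =
      ∫⁻ v, ∫⁻ w, ∫⁻ z, f (g v + h w + z) ∂ν ∂ϖ ∂π := by
    intro f hf
    rw [Measure.snd, lintegral_map hf measurable_snd, lρ _ (by fun_prop)]
  have e1 : klDiv ρ ((π.prod ϖ).prod ρ.snd) = klDiv τ (ϖ.prod (π.prod ρ.snd)) := by
    rw [← klDiv_map_of_leftInverse ρ ((π.prod ϖ).prod ρ.snd) hs hs' (fun _ => rfl)]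
    congr 1
    refine Measure.ext_of_lintegral _ fun f hf => ?_
    rw [lintegral_map hf hs, lintegral_prod _ (Measurable.aemeasurable (by fun_prop)), lintegral_prod,
      lintegral_prod _ hf.aemeasurable, lintegral_lintegral_swap]
    · refine lintegral_congr fun w => ?_
      rw [lintegral_prod]
      exact Measurable.aemeasurable (by fun_prop)
    · exact Measurable.aemeasurable (by fun_prop)
    · exact Measurable.aemeasurable (by fun_prop)
  -- Chain rule `I(v, w; y) = I(v; y) + I(w; v, y)`, valid because `v` and `w` are independent.
  rw [e1, klDiv_prod_eq_add_snd τ]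
  refine add_le_add ?_ ?_
  -- `y` is `g v + z` degraded by the independent disturbance `h w`, so data processing bounds the
  -- first term.
  · have hk : Measurable fun t : (V × E) × W => (t.1.1, t.1.2 + h t.2) := by fun_prop
    have key := klDiv_map_le ((noisyLaw π g ν).prod ϖ)
      ((π.prod (noisyLaw π g ν).snd).prod ϖ) hk
    rw [klDiv_prod_left] at key
    refine le_trans (le_of_eq ?_) key
    congr 1
    · refine Measure.ext_of_lintegral _ fun f hf => ?_
      rw [lτs f hf, lintegral_map hf hk, lintegral_prod _ (Measurable.aemeasurable (by fun_prop)),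
        lintegral_noisyLaw hg (by fun_prop)]
      refine lintegral_congr fun v => ?_
      rw [lintegral_lintegral_swap (Measurable.aemeasurable (by fun_prop))]
      simp only [add_right_comm]
    · refine Measure.ext_of_lintegral _ fun f hf => ?_
      rw [lintegral_map hf hk, lintegral_prod _ hf.aemeasurable,
        lintegral_prod _ (Measurable.aemeasurable (by fun_prop)),
        lintegral_prod _ (Measurable.aemeasurable (by fun_prop))]
      refine lintegral_congr fun v => ?_
      rw [lρs _ (by fun_prop), lintegral_snd_noisyLaw hg (by fun_prop)]
      refine lintegral_congr fun v' => ?_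
      rw [lintegral_lintegral_swap (Measurable.aemeasurable (by fun_prop))]
      simp only [add_right_comm]
  -- Given `v`, subtracting `g v` is invertible and leaves `h w + z`, which is independent of `v`;
  -- the second term is therefore an equality.
  · have hk : Measurable fun t : W × (V × E) => (t.2.1, (t.1, t.2.2 - g t.2.1)) := by fun_prop
    have hk' : Measurable fun t : V × (W × E) => (t.2.1, (t.1, t.2.2 + g t.1)) := by fun_prop
    rw [← klDiv_map_of_leftInverse τ (ϖ.prod τ.snd) hk hk' (fun t => by simp),
      ← klDiv_prod_right (noisyLaw ϖ h ν) _ π]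
    refine le_of_eq ?_
    congr 1
    · refine Measure.ext_of_lintegral _ fun f hf => ?_
      rw [lintegral_map hf hk, lτ _ (by fun_prop), lintegral_prod _ hf.aemeasurable]
      refine lintegral_congr fun v => ?_
      rw [lintegral_noisyLaw hh (by fun_prop)]
      simp [add_assoc]
    · refine Measure.ext_of_lintegral _ fun f hf => ?_
      rw [lintegral_map hf hk, lintegral_prod _ (Measurable.aemeasurable (by fun_prop)),
        lintegral_prod _ hf.aemeasurable]
      calc _ = ∫⁻ w, ∫⁻ v, ∫⁻ w', ∫⁻ z, f (v, (w, h w' + z)) ∂ν ∂ϖ ∂π ∂ϖ := by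
            refine lintegral_congr fun w => ?_
            rw [lτs _ (by fun_prop)]
            simp [add_assoc]
        _ = ∫⁻ v, ∫⁻ w, ∫⁻ w', ∫⁻ z, f (v, (w, h w' + z)) ∂ν ∂ϖ ∂ϖ ∂π := by
            rw [lintegral_lintegral_swap (Measurable.aemeasurable (by fun_prop))]
        _ = _ := by
            refine lintegral_congr fun v => ?_
            rw [lintegral_prod _ (Measurable.aemeasurable (by fun_prop))]
            refine lintegral_congr fun w => ?_
            rw [lintegral_snd_noisyLaw hh (by fun_prop)]

/-- The superposition of `n` iid inputs. -/
theorem mutualInfoOfLaw_noisyLaw_sum_le [MeasurableSub₂ E] [StandardBorelSpace W] [Nonempty W]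
    {n : ℕ} {h : Fin n → W → E} (hh : ∀ i, Measurable (h i)) :
    mutualInfoOfLaw (noisyLaw (Measure.pi fun _ : Fin n => ϖ) (fun v => ∑ i, h i (v i)) ν) ≤
      ∑ i, mutualInfoOfLaw (noisyLaw ϖ (h i) ν) := by
  induction n with
  | zero => simp [mutualInfoOfLaw_noisyLaw_zero]
  | succ n ih =>
    have mp := measurePreserving_piFinSuccAbove (fun _ : Fin (n + 1) => ϖ) 0
    have hinv := (mp.symm _).map_eq
    have hm : Measurable fun v : Fin n → W => ∑ i : Fin n, h i.succ (v i) :=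
      Finset.measurable_sum _ fun i _ => (hh _).comp (measurable_pi_apply i)
    rw [← hinv, Fin.sum_univ_succ]
    refine (mutualInfoOfLaw_noisyLaw_map_le (MeasurableEquiv.measurable _)
      (Finset.measurable_sum _ fun i _ => (hh _).comp (measurable_pi_apply i))).trans ?_
    refine le_trans ?_ (add_le_add le_rfl (ih fun i => hh i.succ))
    refine le_trans (le_of_eq ?_) (mutualInfoOfLaw_noisyLaw_add_le (hh 0) hm)
    congr 2
    funext v
    simp [Fin.sum_univ_succ, MeasurableEquiv.piFinSuccAbove, Fin.insertNthEquiv]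

end AdditiveNoise

/-! ### Divergence and products in terms of densities -/

section Density

variable {α : Type*} [MeasurableSpace α]

theorem klDiv_withDensity_ofReal (τ : Measure α) {F G : α → ℝ}
    (hF : Measurable F) (hG : Measurable G) (hF0 : ∀ x, 0 < F x) (hG0 : ∀ x, 0 < G x)
    {ρ θ : Measure α} [IsProbabilityMeasure ρ] [IsProbabilityMeasure θ]
    (hρ : ρ = τ.withDensity fun x => ENNReal.ofReal (F x))
    (hθ : θ = τ.withDensity fun x => ENNReal.ofReal (G x))
    (hint : Integrable (fun x => Real.log (F x) - Real.log (G x)) ρ) :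
    klDiv ρ θ = ENNReal.ofReal (∫ x, (Real.log (F x) - Real.log (G x)) ∂ρ) := by
  have hq : Measurable fun x => ENNReal.ofReal (F x / G x) := (hF.div hG).ennreal_ofReal
  have h1 : ρ = θ.withDensity fun x => ENNReal.ofReal (F x / G x) := by
    rw [hρ, hθ, ← withDensity_mul _ hG.ennreal_ofReal hq]
    congr 1
    funext x
    rw [Pi.mul_apply, ← ENNReal.ofReal_mul (hG0 x).le, mul_div_cancel₀ _ (hG0 x).ne']
  have hac : ρ ≪ θ := h1 ▸ withDensity_absolutelyContinuous _ _
  have hllr : llr ρ θ =ᵐ[ρ] fun x => Real.log (F x) - Real.log (G x) := by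
    refine hac.ae_le ?_
    have h2 : ρ.rnDeriv θ =ᵐ[θ] fun x => ENNReal.ofReal (F x / G x) := by
      conv_lhs => rw [h1]
      exact Measure.rnDeriv_withDensity θ hq
    filter_upwards [h2] with x hx
    rw [llr, hx, ENNReal.toReal_ofReal (div_nonneg (hF0 x).le (hG0 x).le),
      Real.log_div (hF0 x).ne' (hG0 x).ne']
  rw [klDiv_of_ac_of_integrable hac ((integrable_congr hllr).2 hint), integral_congr_ae hllr]
  -- Both measures have mass one, so the mass correction in `klDiv` vanishes.
  simp

theorem pi_withDensity_ofReal {ι : Type*} [Fintype ι] {E : ι → Type*}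
    [∀ i, MeasurableSpace (E i)] (μ : ∀ i, Measure (E i)) [∀ i, SigmaFinite (μ i)]
    {f : ∀ i, E i → ℝ} (h0 : ∀ i x, 0 ≤ f i x)
    (hi : ∀ i, Integrable (f i) (μ i)) :
    Measure.pi (fun i => (μ i).withDensity fun x => ENNReal.ofReal (f i x)) =
      (Measure.pi μ).withDensity fun x => ENNReal.ofReal (∏ i, f i (x i)) := by
  have : ∀ i, SigmaFinite ((μ i).withDensity fun x => ENNReal.ofReal (f i x)) := fun i =>
    SigmaFinite.withDensity_ofReal _
  refine Measure.pi_eq fun s hs => ?_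
  rw [withDensity_apply _ (MeasurableSet.univ_pi hs), Measure.restrict_pi_pi,
    ← ofReal_integral_eq_lintegral_ofReal, integral_fintype_prod_eq_prod,
    ENNReal.ofReal_prod_of_nonneg fun i _ => integral_nonneg (h0 i)]
  · refine Finset.prod_congr rfl fun i _ => ?_
    rw [withDensity_apply _ (hs i), ofReal_integral_eq_lintegral_ofReal (hi i).restrict
      (ae_of_all _ (h0 i))]
  · exact Integrable.fintype_prod_dep fun i => (hi i).restrict
  · exact ae_of_all _ fun x => Finset.prod_nonneg fun i _ => h0 i _

end Density

/-! ### Complex Gaussian laws and white noise -/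

section ComplexGaussian

theorem measurable_complexOfProd :
    Measurable fun t : ℝ × ℝ => (t.1 : ℂ) + (t.2 : ℂ) * Complex.I := by fun_prop

instance (s : ℝ≥0) : IsProbabilityMeasure (complexGaussian s) :=
  Measure.isProbabilityMeasure_map measurable_complexOfProd.aemeasurable

/-- The density of `𝒞𝒩(0, s)`. -/
noncomputable def complexGaussianPDF (s : ℝ) (y : ℂ) : ℝ := (Real.pi * s)⁻¹ * Real.exp (-‖y‖ ^ 2 / s)

theorem measurable_complexGaussianPDF (s : ℝ) : Measurable (complexGaussianPDF s) := by
  unfold complexGaussianPDF; fun_prop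

theorem complexGaussianPDF_pos {s : ℝ} (hs : 0 < s) (y : ℂ) : 0 < complexGaussianPDF s y := by
  unfold complexGaussianPDF; positivity

theorem log_complexGaussianPDF {s : ℝ} (hs : 0 < s) (y : ℂ) :
    Real.log (complexGaussianPDF s y) = -Real.log Real.pi - Real.log s - ‖y‖ ^ 2 / s := by
  have := Real.pi_pos
  rw [complexGaussianPDF, Real.log_mul (by positivity) (Real.exp_ne_zero _), Real.log_exp,
    Real.log_inv, Real.log_mul this.ne' hs.ne']
  ring

theorem complexGaussian_eq_withDensity {s : ℝ≥0} (hs : s ≠ 0) :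
    complexGaussian s = volume.withDensity fun y => ENNReal.ofReal (complexGaussianPDF s y) := by
  have hs2 : s / 2 ≠ 0 := by positivity
  have hpos : (0 : ℝ) < s := by positivity
  have hpdf : ∀ a b : ℝ, gaussianPDF 0 (s / 2) a * gaussianPDF 0 (s / 2) b =
      ENNReal.ofReal (complexGaussianPDF s (a + b * Complex.I)) := by
    intro a b
    rw [gaussianPDF_def, ← ENNReal.ofReal_mul (gaussianPDFReal_nonneg _ _ _), complexGaussianPDF,
      ← Complex.normSq_eq_norm_sq, Complex.normSq_add_mul_I]
    congr 1
    have e1 : (2 * Real.pi * ((s / 2 : ℝ≥0) : ℝ)) = Real.pi * s := by push_cast; ring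
    have hsq : √(Real.pi * s) * √(Real.pi * s) = Real.pi * s := Real.mul_self_sqrt (by positivity)
    simp only [gaussianPDFReal, e1, sub_zero]
    rw [mul_mul_mul_comm, ← mul_inv, hsq, ← Real.exp_add]
    congr 2
    push_cast
    field_simp
    ring
  refine Measure.ext_of_lintegral _ fun f hf => ?_
  rw [complexGaussian, lintegral_map hf measurable_complexOfProd,
    gaussianReal_of_var_ne_zero _ hs2, prod_withDensity (measurable_gaussianPDF _ _)
    (measurable_gaussianPDF _ _), lintegral_withDensity_eq_lintegral_mul _ _ (by fun_prop),
    lintegral_withDensity_eq_lintegral_mul _ (measurable_complexGaussianPDF _).ennreal_ofReal hf,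
    ← Complex.volume_preserving_equiv_real_prod.symm.lintegral_comp]
  · refine lintegral_congr fun t => ?_
    simp only [Pi.mul_apply, hpdf, Complex.measurableEquivRealProd_symm_apply]
    congr 2 <;> simp [Complex.mk_eq_add_mul_I]
  · exact (measurable_complexGaussianPDF _).ennreal_ofReal.mul hf
  · have := measurable_gaussianPDF 0 (s / 2)
    fun_prop

theorem integrable_complexGaussianPDF {s : ℝ≥0} (hs : s ≠ 0) :
    Integrable (complexGaussianPDF s) := by
  have h : ∫⁻ y, ENNReal.ofReal (complexGaussianPDF s y) = 1 := by
    rw [← setLIntegral_univ, ← withDensity_apply _ MeasurableSet.univ,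
      ← complexGaussian_eq_withDensity hs, measure_univ]
  have hpos : (0 : ℝ) < s := by positivity
  refine ⟨(measurable_complexGaussianPDF _).aestronglyMeasurable, ?_⟩
  rw [hasFiniteIntegral_iff_ofReal (ae_of_all _ fun y => (complexGaussianPDF_pos hpos y).le), h]
  exact ENNReal.one_lt_top

theorem memLp_complexGaussian (s : ℝ≥0) : MemLp (fun y : ℂ => y) 2 (complexGaussian s) := by
  have h : MemLp (fun x : ℝ => x) 2 (gaussianReal 0 (s / 2)) :=
    memLp_id_gaussianReal' 2 (by simp)
  rw [complexGaussian, memLp_map_measure_iff (by fun_prop) measurable_complexOfProd.aemeasurable]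
  have h1 := (h.comp_fst (gaussianReal 0 (s / 2))).ofReal (K := ℂ)
  have h2 := (h.comp_snd (gaussianReal 0 (s / 2))).ofReal (K := ℂ)
  exact h1.add (h2.mul_const Complex.I)

theorem integral_complexGaussian (s : ℝ≥0) : ∫ y : ℂ, y ∂complexGaussian s = 0 := by
  have h : Integrable (fun x : ℝ => x) (gaussianReal 0 (s / 2)) :=
    (memLp_id_gaussianReal' 1 (by simp)).integrable le_rfl
  rw [complexGaussian, integral_map measurable_complexOfProd.aemeasurable (by fun_prop),
    integral_add (h.comp_fst _).ofReal ((h.comp_snd _).ofReal.mul_const _),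
    integral_mul_const]
  have e1 : ∫ t : ℝ × ℝ, (t.1 : ℂ) ∂(gaussianReal 0 (s / 2)).prod (gaussianReal 0 (s / 2)) = 0 := by
    rw [integral_fun_fst (fun x : ℝ => (x : ℂ)), integral_complex_ofReal]; simp
  have e2 : ∫ t : ℝ × ℝ, (t.2 : ℂ) ∂(gaussianReal 0 (s / 2)).prod (gaussianReal 0 (s / 2)) = 0 := by
    rw [integral_fun_snd (fun x : ℝ => (x : ℂ)), integral_complex_ofReal]; simp
  simp [e1, e2]

theorem integral_norm_sq_complexGaussian (s : ℝ≥0) :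
    ∫ y : ℂ, ‖y‖ ^ 2 ∂complexGaussian s = s := by
  have h : Integrable (fun x : ℝ => x ^ 2) (gaussianReal 0 (s / 2)) :=
    (memLp_id_gaussianReal' 2 (by simp)).integrable_sq
  have hv : ∫ x : ℝ, x ^ 2 ∂gaussianReal 0 (s / 2) = s / 2 := by
    have := variance_fun_id_gaussianReal (μ := 0) (v := s / 2)
    rw [variance_eq_integral (by fun_prop)] at this
    simpa using this
  rw [complexGaussian, integral_map measurable_complexOfProd.aemeasurable (by fun_prop)]
  simp_rw [← Complex.normSq_eq_norm_sq, Complex.normSq_add_mul_I]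
  rw [integral_add (h.comp_fst _) (h.comp_snd _), integral_fun_fst (fun x : ℝ => x ^ 2),
    integral_fun_snd (fun x : ℝ => x ^ 2), hv]
  simp

/-- The law of a family of iid entries of law `𝒞𝒩(0, 1)`. -/
noncomputable def complexNoise (ι : Type*) [Fintype ι] : Measure (ι → ℂ) :=
  Measure.pi fun _ => complexGaussian 1

instance (ι : Type*) [Fintype ι] : IsProbabilityMeasure (complexNoise ι) := by
  unfold complexNoise; infer_instance

variable {ι κ : Type*} [Fintype ι] [Fintype κ]

theorem pi_complexGaussian_eq_withDensity {w : ι → ℝ≥0} (hw : ∀ i, w i ≠ 0) :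
    Measure.pi (fun i => complexGaussian (w i)) =
      volume.withDensity fun y => ENNReal.ofReal (∏ i, complexGaussianPDF (w i) (y i)) := by
  simp_rw [fun i => complexGaussian_eq_withDensity (hw i)]
  rw [volume_pi]
  exact pi_withDensity_ofReal (fun _ => volume)
    (fun i y => (complexGaussianPDF_pos (by have := hw i; positivity) y).le)
    fun i => integrable_complexGaussianPDF (hw i)

/-- The functional is only real-linear, so it is determined by its values at `1` and `I`. Real and
imaginary part have variance `1/2`, whence the `4`. -/
theorem charFunDual_complexGaussian (L : StrongDual ℝ ℂ) :
    charFunDual (complexGaussian 1) L =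
      Complex.exp (-((L 1) ^ 2 + (L Complex.I) ^ 2 : ℝ) / 4) := by
  rw [charFunDual_apply, complexGaussian,
    integral_map measurable_complexOfProd.aemeasurable
      (Continuous.aestronglyMeasurable (by fun_prop))]
  have h : ∀ t : ℝ × ℝ, Complex.exp (L ((t.1 : ℂ) + (t.2 : ℂ) * Complex.I) * Complex.I) =
      Complex.exp (L 1 * t.1 * Complex.I) * Complex.exp (L Complex.I * t.2 * Complex.I) := by
    intro t
    have e : (t.1 : ℂ) + (t.2 : ℂ) * Complex.I = t.1 • (1 : ℂ) + t.2 • Complex.I := by simp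
    rw [e, map_add, map_smul, map_smul, ← Complex.exp_add]
    congr 1
    simp only [smul_eq_mul]
    push_cast
    ring
  simp_rw [h]
  rw [integral_prod_mul (fun x : ℝ => Complex.exp (L 1 * x * Complex.I))
    (fun x : ℝ => Complex.exp (L Complex.I * x * Complex.I))]
  rw [← charFun_apply_real, ← charFun_apply_real, charFun_gaussianReal, charFun_gaussianReal,
    ← Complex.exp_add]
  congr 1
  push_cast
  ring

/-- White noise is invariant under coisometries. -/
theorem map_complexNoise_mulVec [DecidableEq ι] [DecidableEq κ] {M : Matrix ι κ ℂ}
    (hM : M * Mᴴ = 1) : (complexNoise κ).map (fun z => M *ᵥ z) = complexNoise ι := by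
  have hmeas : Measurable fun z : κ → ℂ => M *ᵥ z :=
    (Matrix.mulVecLin M).continuous_of_finiteDimensional.measurable
  have : IsProbabilityMeasure ((complexNoise κ).map fun z => M *ᵥ z) :=
    Measure.isProbabilityMeasure_map hmeas.aemeasurable
  refine Measure.ext_of_charFunDual (funext fun L => ?_)
  let ML : (κ → ℂ) →L[ℝ] (ι → ℂ) := (Matrix.mulVecLin M).toContinuousLinearMap.restrictScalars ℝ
  have hML : (fun z : κ → ℂ => M *ᵥ z) = ML := rfl
  rw [hML, charFunDual_map, complexNoise, complexNoise, charFunDual_pi, charFunDual_pi]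
  simp_rw [charFunDual_complexGaussian, ← Complex.exp_sum, ← Finset.sum_div, Finset.sum_neg_distrib,
    ← Complex.ofReal_sum]
  congr 4
  -- The vector representing `L` as `y ↦ Re ⟨c, y⟩`. The two exponents are then `‖cᴴ M‖²` and
  -- `‖c‖²`, equal because `M Mᴴ = 1`.
  set c : ι → ℂ := fun i => ⟨L (Pi.single i 1), L (Pi.single i Complex.I)⟩ with hc
  have hL : ∀ y : ι → ℂ, L y = (star c ⬝ᵥ y).re := by
    intro y
    have e : y = ∑ i, ((y i).re • (Pi.single i 1 : ι → ℂ) +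
        (y i).im • (Pi.single i Complex.I : ι → ℂ)) := by
      funext j
      simp [Finset.sum_apply, Pi.single_apply, Finset.sum_add_distrib, Complex.re_add_im]
    conv_lhs => rw [e]
    simp only [map_sum, map_add, map_smul, smul_eq_mul, dotProduct, Complex.re_sum]
    refine Finset.sum_congr rfl fun i _ => ?_
    simp [hc]
    ring
  have hsum : ∑ i, ‖c i‖ ^ 2 = (star c ⬝ᵥ c).re := by
    simp [dotProduct, ← Complex.normSq_eq_norm_sq, Complex.normSq_apply]
  have h1 : ∀ k, (L (M *ᵥ Pi.single k 1)) ^ 2 + (L (M *ᵥ Pi.single k Complex.I)) ^ 2 =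
      ‖(star c ᵥ* M) k‖ ^ 2 := by
    intro k
    rw [hL, hL, Matrix.dotProduct_mulVec, Matrix.dotProduct_mulVec, dotProduct_single,
      dotProduct_single, ← Complex.normSq_eq_norm_sq, Complex.normSq_apply]
    simp
    ring
  have h2 : ∑ k, ‖(star c ᵥ* M) k‖ ^ 2 = (star c ⬝ᵥ c).re := by
    have e : star c ⬝ᵥ c = (star c ᵥ* M) ⬝ᵥ star (star c ᵥ* M) := by
      rw [Matrix.star_vecMul, star_star, Matrix.dotProduct_mulVec, Matrix.vecMul_vecMul, hM,
        Matrix.vecMul_one]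
    rw [e]
    simp [dotProduct, ← Complex.normSq_eq_norm_sq, Complex.normSq_apply]
  calc _ = ∑ k, ‖(star c ᵥ* M) k‖ ^ 2 := Finset.sum_congr rfl fun k _ => h1 k
    _ = ∑ i, ‖c i‖ ^ 2 := by rw [h2, hsum]
    _ = _ := by
      refine Finset.sum_congr rfl fun i _ => ?_
      rw [← Complex.normSq_eq_norm_sq, Complex.normSq_apply]
      simp [hc, sq]

end ComplexGaussian

/-! ### Channels with white Gaussian noise -/

section GaussianChannel

variable {V : Type*} [MeasurableSpace V] {π : Measure V} [IsProbabilityMeasure π]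
  {ι : Type*} [Fintype ι]

/-- The reference measure is `π ⊗ volume`, since the input law may have atoms. The formula is
translation invariance of `volume`. -/
theorem noisyLaw_complexNoise_eq_withDensity {g : V → ι → ℂ} (hg : Measurable g) :
    noisyLaw π g (complexNoise ι) = (π.prod volume).withDensity
      fun t => ENNReal.ofReal (∏ i, complexGaussianPDF 1 ((t.2 - g t.1) i)) := by
  have hP : Measurable fun y : ι → ℂ => ENNReal.ofReal (∏ i, complexGaussianPDF 1 (y i)) :=
    (Finset.measurable_prod _ fun i _ =>
      (measurable_complexGaussianPDF 1).comp (measurable_pi_apply i)).ennreal_ofReal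
  have hd : Measurable fun t : V × (ι → ℂ) => t.2 - g t.1 := by fun_prop
  have hPd : Measurable fun t : V × (ι → ℂ) =>
      ENNReal.ofReal (∏ i, complexGaussianPDF 1 ((t.2 - g t.1) i)) := hP.comp hd
  have hnoise := pi_complexGaussian_eq_withDensity (w := fun _ : ι => 1) (by simp)
  simp only [NNReal.coe_one] at hnoise
  refine Measure.ext_of_lintegral _ fun f hf => ?_
  rw [lintegral_noisyLaw hg hf, lintegral_withDensity_eq_lintegral_mul _ hPd hf,
    lintegral_prod _ (hPd.mul hf).aemeasurable]
  refine lintegral_congr fun v => ?_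
  rw [complexNoise, hnoise, lintegral_withDensity_eq_lintegral_mul _ hP (by fun_prop)]
  conv_rhs => rw [← lintegral_add_left_eq_self _ (g v)]
  simp

theorem memLp_complexNoise (i : ι) : MemLp (fun z : ι → ℂ => z i) 2 (complexNoise ι) :=
  (memLp_complexGaussian 1).comp_measurePreserving
    (measurePreserving_eval (fun _ : ι => complexGaussian 1) i)

theorem integral_complexNoise (i : ι) {f : ℂ → ℝ} (hf : Measurable f) :
    ∫ z, f (z i) ∂complexNoise ι = ∫ y, f y ∂complexGaussian 1 := by
  rw [← (measurePreserving_eval (fun _ : ι => complexGaussian 1) i).map_eq,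
    integral_map (measurable_pi_apply i).aemeasurable hf.aestronglyMeasurable]
  rfl

theorem integral_complexNoise_apply (i : ι) : ∫ z, z i ∂complexNoise ι = 0 := by
  rw [← integral_complexGaussian 1,
    ← (measurePreserving_eval (fun _ : ι => complexGaussian 1) i).map_eq,
    integral_map (measurable_pi_apply i).aemeasurable (by fun_prop)]
  rfl

/-- The second moment of an independent sum with a centred second summand. -/
theorem integral_norm_add_sq {W : Type*} [MeasurableSpace W] {ν : Measure W}
    [IsProbabilityMeasure ν] {f : V → ℂ} {h : W → ℂ} (hf : MemLp f 2 π) (hh : MemLp h 2 ν)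
    (h0 : ∫ w, h w ∂ν = 0) :
    Integrable (fun t : V × W => ‖f t.1 + h t.2‖ ^ 2) (π.prod ν) ∧
    ∫ t : V × W, ‖f t.1 + h t.2‖ ^ 2 ∂π.prod ν = ∫ v, ‖f v‖ ^ 2 ∂π + ∫ w, ‖h w‖ ^ 2 ∂ν := by
  have i1 : Integrable (fun t : V × W => ‖f t.1‖ ^ 2) (π.prod ν) :=
    (hf.integrable_norm_pow (by simp)).comp_fst ν
  have i2 : Integrable (fun t : V × W => ‖h t.2‖ ^ 2) (π.prod ν) :=
    (hh.integrable_norm_pow (by simp)).comp_snd π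
  have i3 : Integrable (fun t : V × W => star (f t.1) * h t.2) (π.prod ν) :=
    (Complex.conjCLE.toContinuousLinearMap.integrable_comp (hf.integrable (by simp))).mul_prod
      (hh.integrable (by simp))
  have e : ∀ t : V × W, ‖f t.1 + h t.2‖ ^ 2 =
      ‖f t.1‖ ^ 2 + ‖h t.2‖ ^ 2 + 2 * (star (f t.1) * h t.2).re := by
    intro t
    simp only [← Complex.normSq_eq_norm_sq, Complex.normSq_apply]
    simp
    ring
  have c0 : ∫ t : V × W, (star (f t.1) * h t.2).re ∂π.prod ν = 0 := by
    have := Complex.reCLM.integral_comp_comm i3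
    simp only [Complex.reCLM_apply] at this
    rw [this, integral_prod_mul (fun v => star (f v)) h, h0]
    simp
  have i4 : Integrable (fun t : V × W => 2 * (star (f t.1) * h t.2).re) (π.prod ν) :=
    i3.re.const_mul 2
  have i5 : Integrable (fun t : V × W => ‖f t.1‖ ^ 2 + ‖h t.2‖ ^ 2) (π.prod ν) := i1.add i2
  simp_rw [e]
  refine ⟨i5.add i4, ?_⟩
  rw [integral_add i5 i4, integral_add i1 i2, integral_const_mul, c0,
    integral_fun_fst (fun v => ‖f v‖ ^ 2), integral_fun_snd (fun w => ‖h w‖ ^ 2)]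
  simp

/-- The divergence of a Gaussian channel from independent Gaussian outputs. -/
theorem klDiv_noisyLaw_complexNoise {g : V → ι → ℂ} (hg : Measurable g)
    (hg2 : ∀ i, MemLp (fun v => g v i) 2 π) {w : ι → ℝ≥0} (hw : ∀ i, w i ≠ 0) :
    klDiv (noisyLaw π g (complexNoise ι)) (π.prod (Measure.pi fun i => complexGaussian (w i))) =
      ENNReal.ofReal (∑ i, (Real.log (w i) - 1 + (∫ v, ‖g v i‖ ^ 2 ∂π + 1) / w i)) := by
  have hpos : ∀ i, (0 : ℝ) < w i := fun i => by have := hw i; positivity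
  have hF : Measurable fun t : V × (ι → ℂ) => ∏ i, complexGaussianPDF 1 ((t.2 - g t.1) i) :=
    Finset.measurable_prod _ fun i _ => (measurable_complexGaussianPDF 1).comp (by fun_prop)
  have hG : Measurable fun t : V × (ι → ℂ) => ∏ i, complexGaussianPDF (w i) (t.2 i) :=
    Finset.measurable_prod _ fun i _ => (measurable_complexGaussianPDF _).comp (by fun_prop)
  have hP := isProbabilityMeasure_noisyLaw (π := π) (ν := complexNoise ι) hg
  have hm := measurable_noisyMap (V := V) hg
  have hlog : ∀ t : V × (ι → ℂ), Real.log (∏ i, complexGaussianPDF 1 ((t.2 - g t.1) i)) -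
      Real.log (∏ i, complexGaussianPDF (w i) (t.2 i)) =
      ∑ i, (Real.log (w i) - ‖t.2 i - g t.1 i‖ ^ 2 + ‖t.2 i‖ ^ 2 / w i) := by
    intro t
    rw [Real.log_prod fun i _ => (complexGaussianPDF_pos one_pos _).ne',
      Real.log_prod fun i _ => (complexGaussianPDF_pos (hpos i) _).ne', ← Finset.sum_sub_distrib]
    refine Finset.sum_congr rfl fun i _ => ?_
    rw [log_complexGaussianPDF one_pos, log_complexGaussianPDF (hpos i)]
    simp
    ring
  have hz : ∀ i, Integrable (fun t : V × (ι → ℂ) => ‖t.2 i‖ ^ 2) (π.prod (complexNoise ι)) :=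
    fun i => ((memLp_complexNoise i).integrable_norm_pow (by simp)).comp_snd π
  have hs := fun i => integral_norm_add_sq (hg2 i) (memLp_complexNoise i)
    (integral_complexNoise_apply i)
  have hterm : ∀ i, Integrable (fun t : V × (ι → ℂ) =>
      Real.log (w i) - ‖t.2 i‖ ^ 2 + ‖g t.1 i + t.2 i‖ ^ 2 / w i) (π.prod (complexNoise ι)) :=
    fun i => ((integrable_const _).sub (hz i)).add ((hs i).1.div_const _)
  -- Pulled back to input and noise, the residual `y - g v` is the noise itself.
  have hsum : ∀ t : V × (ι → ℂ), ∑ i, (Real.log (w i) - ‖(g t.1 + t.2) i - g t.1 i‖ ^ 2 +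
      ‖(g t.1 + t.2) i‖ ^ 2 / w i) =
      ∑ i, (Real.log (w i) - ‖t.2 i‖ ^ 2 + ‖g t.1 i + t.2 i‖ ^ 2 / w i) := by
    intro t; simp
  have hlm : Measurable fun t : V × (ι → ℂ) =>
      ∑ i, (Real.log (w i) - ‖t.2 i - g t.1 i‖ ^ 2 + ‖t.2 i‖ ^ 2 / w i) := by fun_prop
  rw [klDiv_withDensity_ofReal (π.prod volume) hF hG
    (fun t => Finset.prod_pos fun i _ => complexGaussianPDF_pos one_pos _)
    (fun t => Finset.prod_pos fun i _ => complexGaussianPDF_pos (hpos i) _)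
    (noisyLaw_complexNoise_eq_withDensity hg)]
  · congr 1
    simp_rw [hlog]
    rw [noisyLaw, integral_map hm.aemeasurable hlm.aestronglyMeasurable]
    simp only [hsum]
    rw [integral_finsetSum _ fun i _ => hterm i]
    refine Finset.sum_congr rfl fun i _ => ?_
    have hd : Integrable (fun t : V × (ι → ℂ) => Real.log (w i) - ‖t.2 i‖ ^ 2)
        (π.prod (complexNoise ι)) := (integrable_const _).sub (hz i)
    rw [integral_add hd ((hs i).1.div_const _),
      integral_sub (integrable_const _) (hz i), integral_div, (hs i).2,
      integral_fun_snd (fun z : ι → ℂ => ‖z i‖ ^ 2),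
      integral_complexNoise i (f := fun y => ‖y‖ ^ 2) (by fun_prop),
      integral_norm_sq_complexGaussian]
    simp
  · rw [pi_complexGaussian_eq_withDensity hw, prod_withDensity_right]
    exact (Finset.measurable_prod _ fun i _ => (measurable_complexGaussianPDF _).comp
      (measurable_pi_apply i)).ennreal_ofReal
  · simp_rw [hlog]
    rw [noisyLaw, integrable_map_measure hlm.aestronglyMeasurable hm.aemeasurable]
    simp only [Function.comp_def, hsum]
    exact integrable_finsetSum _ fun i _ => hterm i

end GaussianChannel

/-! ### Concavity from decreasing increments -/

section Concavity

/-- The chord slopes from `0` decrease, as each new increment is at most the average of the earlier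
ones (`h1`). -/
theorem mul_sub_le_of_antitone_increments {u : ℕ → ℝ}
    (hu : ∀ j, u (j + 2) + u j ≤ 2 * u (j + 1)) {k N : ℕ} (hk : k ≤ N) :
    k * (u N - u 0) ≤ N * (u k - u 0) := by
  have h1 : ∀ j : ℕ, j * (u (j + 1) - u j) ≤ u j - u 0 := by
    intro j
    induction j with
    | zero => simp
    | succ j ih =>
      have := hu j
      have hj : (0 : ℝ) ≤ j := j.cast_nonneg
      push_cast
      nlinarith
  induction N, hk using Nat.le_induction with
  | base => exact le_rfl
  | succ N hN ih =>
    rcases Nat.eq_zero_or_pos N with rfl | hpos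
    · obtain rfl : k = 0 := by omega
      simp
    · have hN0 : (0 : ℝ) < N := by exact_mod_cast hpos
      have hk0 : (0 : ℝ) ≤ k := k.cast_nonneg
      have h2 : N * (u (N + 1) - u 0) ≤ (N + 1) * (u N - u 0) := by linarith [h1 N]
      have h3 := mul_le_mul_of_nonneg_left h2 hk0
      have h4 := mul_le_mul_of_nonneg_left ih (by positivity : (0 : ℝ) ≤ N + 1)
      push_cast
      refine le_of_mul_le_mul_left ?_ hN0
      linarith

/-- Decreasing increments give the chord inequality at grid points of `[x, y]`. Monotonicity takes
the place of continuity in passing to arbitrary points. -/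
theorem concaveOn_of_monotone_of_antitone_increments {f : ℝ → ℝ}
    (hmono : ∀ s t, 0 ≤ s → s ≤ t → f s ≤ f t)
    (hinc : ∀ s d, 0 ≤ s → 0 ≤ d → f (s + 2 * d) + f s ≤ 2 * f (s + d)) :
    ConcaveOn ℝ (Set.Ici 0) f := by
  refine LinearOrder.concaveOn_of_lt (convex_Ici 0) fun x hx y hy hxy a b ha hb hab => ?_
  have hx0 : 0 ≤ x := hx
  have key : ∀ N : ℕ, 0 < N → (⌊b * N⌋₊ / N : ℝ) * (f y - f x) ≤ f (a • x + b • y) - f x := by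
    intro N hN
    have hN0 : (0 : ℝ) < N := by exact_mod_cast hN
    have hfl : (⌊b * N⌋₊ : ℝ) ≤ b * N := Nat.floor_le (by positivity)
    have hkN : ⌊b * N⌋₊ ≤ N := by
      have : (⌊b * N⌋₊ : ℝ) ≤ N := hfl.trans (by nlinarith)
      exact_mod_cast this
    set d := (y - x) / N with hd
    have hd0 : 0 ≤ d := div_nonneg (by linarith) hN0.le
    have h := mul_sub_le_of_antitone_increments (u := fun j : ℕ => f (x + j * d))
      (fun j => by
        have := hinc (x + j * d) d (by positivity) hd0
        push_cast
        convert this using 3 <;> ring_nf) hkN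
    have hy' : x + N * d = y := by rw [hd]; field_simp; ring
    simp only [hy', Nat.cast_zero, zero_mul, add_zero] at h
    -- Rounding `b * N` down keeps the grid point to the left of `a x + b y`, where `f` is smaller;
    -- the rounding error disappears as `N` grows.
    have hle : f (x + ⌊b * N⌋₊ * d) ≤ f (a • x + b • y) := by
      refine hmono _ _ (by positivity) ?_
      have e : a • x + b • y = x + (b * N) * d := by
        rw [hd]; simp only [smul_eq_mul]; field_simp
        have : a = 1 - b := by linarith
        rw [this]; ring
      rw [e]
      gcongr
    rw [div_mul_eq_mul_div, div_le_iff₀ hN0]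
    nlinarith
  have hlim : Tendsto (fun N : ℕ => (⌊b * N⌋₊ / N : ℝ) * (f y - f x)) atTop
      (𝓝 (b * (f y - f x))) :=
    ((tendsto_nat_floor_mul_div_atTop hb.le).comp tendsto_natCast_atTop_atTop).mul_const _
  have := le_of_tendsto hlim (eventually_atTop.2 ⟨1, fun N hN => key N hN⟩)
  simp only [smul_eq_mul] at this ⊢
  have ha' : a = 1 - b := by linarith
  rw [ha'] at this ⊢
  linarith

theorem _root_.ConcaveOn.exists_supergradient {f : ℝ → ℝ} {S : Set ℝ} (hf : ConcaveOn ℝ S f)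
    {m : ℝ} (hm : m ∈ interior S) : ∃ c, ∀ t ∈ S, f t ≤ f m + c * (t - m) := by
  have hφ := hf.neg
  refine ⟨-derivWithin (-f) (Set.Ioi m) m, fun t ht => ?_⟩
  rcases lt_trichotomy t m with h | rfl | h
  · have h1 := hφ.slope_le_leftDeriv_of_mem_interior ht hm h
    have h2 := hφ.leftDeriv_le_rightDeriv_of_mem_interior hm
    have h3 := h1.trans h2
    rw [slope_def_field, div_le_iff₀ (by linarith)] at h3
    simp only [Pi.neg_apply] at h3
    linarith
  · simp
  · have h3 := hφ.rightDeriv_le_slope_of_mem_interior hm ht h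
    rw [slope_def_field, le_div_iff₀ (by linarith)] at h3
    simp only [Pi.neg_apply] at h3
    linarith

end Concavity

/-! ### Second moments of linear combinations of iid entries -/

section SecondMoment

variable {π₀ : Measure ℂ} [IsProbabilityMeasure π₀]

theorem memLp_sum_mul (h2 : MemLp (fun v : ℂ => v) 2 π₀) {ι : Type*} [Fintype ι] (c : ι → ℂ) :
    MemLp (fun v : ι → ℂ => ∑ j, c j * v j) 2 (Measure.pi fun _ => π₀) :=
  memLp_finsetSum _ fun j _ =>
    (h2.comp_measurePreserving (measurePreserving_eval (fun _ : ι => π₀) j)).const_mul (c j)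

theorem integral_sum_mul (h2 : MemLp (fun v : ℂ => v) 2 π₀) (h0 : ∫ v, v ∂π₀ = 0) {ι : Type*}
    [Fintype ι] (c : ι → ℂ) : ∫ v : ι → ℂ, ∑ j, c j * v j ∂(Measure.pi fun _ => π₀) = 0 := by
  have hj := fun j => measurePreserving_eval (fun _ : ι => π₀) j
  have hi : ∀ j, Integrable (fun v : ι → ℂ => c j * v j) (Measure.pi fun _ => π₀) := fun j =>
    ((h2.comp_measurePreserving (hj j)).integrable (by simp)).const_mul (c j)
  rw [integral_finsetSum _ fun j _ => hi j]
  refine Finset.sum_eq_zero fun j _ => ?_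
  rw [integral_const_mul]
  have : ∫ v : ι → ℂ, v j ∂(Measure.pi fun _ => π₀) = 0 := by
    have h := integral_map (μ := Measure.pi fun _ : ι => π₀) (f := fun v : ℂ => v)
      (measurable_pi_apply j).aemeasurable (by fun_prop)
    rw [← h, ← h0]
    exact congrArg (fun ν : Measure ℂ => ∫ v, v ∂ν) (hj j).map_eq
  simp [this]

theorem integral_norm_sum_mul_sq (h2 : MemLp (fun v : ℂ => v) 2 π₀) (h0 : ∫ v, v ∂π₀ = 0)
    {n : ℕ} (c : Fin n → ℂ) :
    ∫ v : Fin n → ℂ, ‖∑ j, c j * v j‖ ^ 2 ∂(Measure.pi fun _ => π₀) =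
      (∑ j, ‖c j‖ ^ 2) * ∫ v, ‖v‖ ^ 2 ∂π₀ := by
  induction n with
  | zero => simp
  | succ n ih =>
    let e : (Fin (n + 1) → ℂ) ≃ᵐ ℂ × (Fin n → ℂ) :=
      MeasurableEquiv.piFinSuccAbove (fun _ : Fin (n + 1) => ℂ) 0
    have mp : MeasurePreserving e (Measure.pi fun _ => π₀) (π₀.prod (Measure.pi fun _ => π₀)) :=
      measurePreserving_piFinSuccAbove (fun _ : Fin (n + 1) => π₀) 0
    have hsum : ∀ v : Fin (n + 1) → ℂ, ‖∑ j, c j * v j‖ ^ 2 =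
        ‖c 0 * (e v).1 + ∑ j : Fin n, c j.succ * (e v).2 j‖ ^ 2 := by
      intro v
      rw [Fin.sum_univ_succ]
      rfl
    simp_rw [hsum]
    rw [mp.integral_comp' fun t : ℂ × (Fin n → ℂ) => ‖c 0 * t.1 + ∑ j : Fin n, c j.succ * t.2 j‖ ^ 2]
    have hl : MemLp (fun v : ℂ => c 0 * v) 2 π₀ := h2.const_mul (c 0)
    have hm : MemLp (fun v : Fin n → ℂ => ∑ j, c j.succ * v j) 2 (Measure.pi fun _ => π₀) :=
      memLp_sum_mul (ι := Fin n) h2 fun j => c j.succ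
    have hz : ∫ v : Fin n → ℂ, ∑ j, c j.succ * v j ∂(Measure.pi fun _ => π₀) = 0 :=
      integral_sum_mul (ι := Fin n) h2 h0 fun j => c j.succ
    have key := (integral_norm_add_sq (π := π₀) (ν := Measure.pi fun _ : Fin n => π₀)
      (f := fun v => c 0 * v) (h := fun v => ∑ j, c j.succ * v j) hl hm hz).2
    rw [ih] at key
    rw [key, Fin.sum_univ_succ, add_mul]
    simp [mul_pow, integral_const_mul]

end SecondMoment

/-! ### The log-determinant bound -/

section LogDet

variable {n : ℕ}

theorem measurable_mulVec {ι κ : Type*} [Fintype ι] [Fintype κ] (M : Matrix ι κ ℂ) :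
    Measurable fun z : κ → ℂ => M *ᵥ z :=
  (Matrix.mulVecLin M).continuous_of_finiteDimensional.measurable

theorem mutualInfoOfLaw_noisyLaw_mulVec_le {V : Type*} [MeasurableSpace V] {π : Measure V}
    [IsProbabilityMeasure π] {ι κ : Type*} [Fintype ι] [Fintype κ] [DecidableEq ι] [DecidableEq κ]
    {g : V → κ → ℂ} (hg : Measurable g) {M : Matrix ι κ ℂ} (hM : M * Mᴴ = 1) :
    mutualInfoOfLaw (noisyLaw π (fun v => M *ᵥ g v) (complexNoise ι)) ≤
      mutualInfoOfLaw (noisyLaw π g (complexNoise κ)) := by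
  rw [← map_complexNoise_mulVec hM]
  exact mutualInfoOfLaw_noisyLaw_output_le (Matrix.mulVecLin M).toAddMonoidHom
    (measurable_mulVec M) hg

/-- The Gaussian bound on the mutual information of a linear channel with iid centred inputs. -/
theorem mutualInfoOfLaw_mulVec_le_sum_log {π₀ : Measure ℂ} [IsProbabilityMeasure π₀]
    (h2 : MemLp (fun v : ℂ => v) 2 π₀) (h0 : ∫ v, v ∂π₀ = 0) (H : Matrix (Fin n) (Fin n) ℂ)
    {R : Matrix (Fin n) (Fin n) ℂ} (hR : R.IsHermitian) (hRH : R = Hᴴ * H) :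
    mutualInfoOfLaw (noisyLaw (Measure.pi fun _ => π₀) (fun v => H *ᵥ v) (complexNoise (Fin n))) ≤
      ENNReal.ofReal (∑ i, Real.log (1 + (∫ v, ‖v‖ ^ 2 ∂π₀) * hR.eigenvalues i)) := by
  set s := ∫ v, ‖v‖ ^ 2 ∂π₀ with hs
  have hs0 : 0 ≤ s := integral_nonneg fun v => by positivity
  have hB : (H * Hᴴ).IsHermitian := Matrix.isHermitian_mul_conjTranspose_self H
  -- `Hᴴ H` and `H Hᴴ` are square with the same characteristic polynomial. The rotation has to act
  -- on the output side, so `H Hᴴ` is the one diagonalized.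
  have heig : hR.eigenvalues = hB.eigenvalues := by
    rw [Matrix.IsHermitian.eigenvalues_eq_eigenvalues_iff, hRH, Matrix.charpoly_mul_comm]
  set W : Matrix (Fin n) (Fin n) ℂ := hB.eigenvectorUnitary.1 with hW
  have hWW : W * Wᴴ = 1 := Unitary.coe_mul_star_self hB.eigenvectorUnitary
  set G := Wᴴ * H with hG
  have hGG : G * Gᴴ = Matrix.diagonal (fun i => (hB.eigenvalues i : ℂ)) := by
    have := hB.conjStarAlgAut_star_eigenvectorUnitary
    rw [Unitary.conjStarAlgAut_star_apply] at this
    rw [hG, Matrix.conjTranspose_mul, Matrix.conjTranspose_conjTranspose, Matrix.mul_assoc,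
      ← Matrix.mul_assoc H, ← Matrix.mul_assoc]
    exact this
  have hrow : ∀ i, ∑ j, ‖G i j‖ ^ 2 = hB.eigenvalues i := by
    intro i
    have h := congrArg Complex.re (congrFun (congrFun hGG i) i)
    rw [Matrix.mul_apply, Matrix.diagonal_apply_eq] at h
    simpa [← Complex.normSq_eq_norm_sq, Complex.normSq_apply] using h
  have hlam : ∀ i, 0 ≤ hB.eigenvalues i := fun i =>
    hrow i ▸ Finset.sum_nonneg fun j _ => by positivity
  have hHG : ∀ v, H *ᵥ v = W *ᵥ (G *ᵥ v) := by
    intro v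
    rw [hG, Matrix.mulVec_mulVec, ← Matrix.mul_assoc, hWW, Matrix.one_mul]
  simp_rw [hHG]
  have hGm := measurable_mulVec G
  refine (mutualInfoOfLaw_noisyLaw_mulVec_le hGm hWW).trans ?_
  -- The true output variances. With this choice the quadratic terms cancel the `-1`, leaving only
  -- logarithms.
  set w : Fin n → ℝ≥0 := fun i => (1 + s * hB.eigenvalues i).toNNReal with hw
  have hwc : ∀ i, (w i : ℝ) = 1 + s * hB.eigenvalues i := fun i =>
    Real.coe_toNNReal _ (by have := hlam i; positivity)
  have hw0 : ∀ i, w i ≠ 0 := fun i => by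
    have := hlam i
    rw [← NNReal.coe_ne_zero, hwc]
    positivity
  have key := klDiv_noisyLaw_eq_add (π := Measure.pi fun _ : Fin n => π₀)
    (ν := complexNoise (Fin n)) hGm (Measure.pi fun i => complexGaussian (w i))
  rw [klDiv_noisyLaw_complexNoise hGm (fun i => memLp_sum_mul h2 (G i)) hw0] at key
  refine (le_add_self.trans_eq key.symm).trans (le_of_eq ?_)
  congr 1
  rw [heig]
  refine Finset.sum_congr rfl fun i _ => ?_
  have hi := hwc i
  have hi0 : (w i : ℝ) ≠ 0 := by exact_mod_cast hw0 i
  have e : ∫ v : Fin n → ℂ, ‖(G *ᵥ v) i‖ ^ 2 ∂(Measure.pi fun _ => π₀) =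
      hB.eigenvalues i * s := by
    rw [← hrow]
    exact integral_norm_sum_mul_sq h2 h0 (G i)
  rw [e, ← hi, show hB.eigenvalues i * s + 1 = w i by rw [hi]; ring, div_self hi0]
  ring

end LogDet

/-! ### Matched filter, scalar channel and concavity of its information -/

section MatchedFilter

variable {π₀ : Measure ℂ} [IsProbabilityMeasure π₀]

/-- The channel that multiplies a scalar input by the vector `h` and adds white noise. -/
noncomputable def vectorLaw (π₀ : Measure ℂ) {ι : Type*} [Fintype ι] (h : ι → ℂ) :
    Measure (ℂ × (ι → ℂ)) :=
  noisyLaw π₀ (fun v i => h i * v) (complexNoise ι)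

/-- The mutual information `I(V; √s V + Z)`. -/
noncomputable def scalarInfo (π₀ : Measure ℂ) (s : ℝ) : ℝ≥0∞ :=
  mutualInfoOfLaw (vectorLaw π₀ fun _ : Fin 1 => (√s : ℂ))

/-- The divergence of the law of `√s V + Z` from the law of `Z`. -/
noncomputable def scalarDiv (π₀ : Measure ℂ) (s : ℝ) : ℝ≥0∞ :=
  klDiv (vectorLaw π₀ fun _ : Fin 1 => (√s : ℂ)).snd (complexNoise (Fin 1))

variable {ι κ : Type*} [Fintype ι] [Fintype κ] [DecidableEq ι] [DecidableEq κ]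

theorem measurable_mul_vector (h : ι → ℂ) : Measurable fun (v : ℂ) (i : ι) => h i * v := by
  fun_prop

instance (h : ι → ℂ) : IsProbabilityMeasure (vectorLaw π₀ h) :=
  isProbabilityMeasure_noisyLaw (measurable_mul_vector h)

/-- With unit variances as reference the total depends on `h` only through its norm. This
conservation law drives both the matched filter and the concavity. -/
theorem klDiv_add_mutualInfoOfLaw_vectorLaw (h2 : MemLp (fun v : ℂ => v) 2 π₀) (h : ι → ℂ) :
    klDiv (vectorLaw π₀ h).snd (complexNoise ι) + mutualInfoOfLaw (vectorLaw π₀ h) =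
      ENNReal.ofReal ((∑ i, ‖h i‖ ^ 2) * ∫ v, ‖v‖ ^ 2 ∂π₀) := by
  have key := klDiv_noisyLaw_eq_add (π := π₀) (ν := complexNoise ι) (measurable_mul_vector h)
    (complexNoise ι)
  rw [vectorLaw, ← key, complexNoise]
  have := klDiv_noisyLaw_complexNoise (π := π₀) (measurable_mul_vector h)
    (fun i => h2.const_mul (h i)) (w := fun _ => 1) (by simp)
  rw [complexNoise] at this
  rw [this, Finset.sum_mul]
  simp [mul_pow, integral_const_mul]

theorem map_mulVec_vectorLaw (h : κ → ℂ) {M : Matrix ι κ ℂ} (hM : M * Mᴴ = 1) :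
    (vectorLaw π₀ h).snd.map (fun z => M *ᵥ z) = (vectorLaw π₀ (M *ᵥ h)).snd := by
  have key := snd_noisyLaw_map_output (π := π₀) (ν := complexNoise κ)
    (Matrix.mulVecLin M).toAddMonoidHom (measurable_mulVec M) (measurable_mul_vector h)
  have e : ((Matrix.mulVecLin M).toAddMonoidHom ∘ fun (v : ℂ) (i : κ) => h i * v) =
      fun v i => (M *ᵥ h) i * v := by
    funext v i
    simp [Matrix.mulVec, dotProduct, Finset.sum_mul, mul_assoc]
  rw [e] at key
  rw [vectorLaw, vectorLaw, ← map_complexNoise_mulVec hM]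
  exact key

theorem klDiv_vectorLaw_mulVec_le (h : κ → ℂ) {M : Matrix ι κ ℂ} (hM : M * Mᴴ = 1) :
    klDiv (vectorLaw π₀ (M *ᵥ h)).snd (complexNoise ι) ≤
      klDiv (vectorLaw π₀ h).snd (complexNoise κ) := by
  rw [← map_mulVec_vectorLaw h hM, ← map_complexNoise_mulVec hM]
  exact klDiv_map_le _ _ (measurable_mulVec M)

theorem mutualInfoOfLaw_vectorLaw_mulVec_le (h : κ → ℂ) {M : Matrix ι κ ℂ} (hM : M * Mᴴ = 1) :
    mutualInfoOfLaw (vectorLaw π₀ (M *ᵥ h)) ≤ mutualInfoOfLaw (vectorLaw π₀ h) := by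
  refine le_trans (le_of_eq ?_)
    (mutualInfoOfLaw_noisyLaw_mulVec_le (π := π₀) (measurable_mul_vector h) hM)
  rw [vectorLaw]
  congr 2
  funext v i
  simp [Matrix.mulVec, dotProduct, Finset.sum_mul, mul_assoc]

/-- A matched filter is a sufficient statistic. -/
theorem vectorLaw_eq_scalar (h2 : MemLp (fun v : ℂ => v) 2 π₀) (h : ι → ℂ) :
    klDiv (vectorLaw π₀ h).snd (complexNoise ι) = scalarDiv π₀ (∑ i, ‖h i‖ ^ 2) ∧
      mutualInfoOfLaw (vectorLaw π₀ h) = scalarInfo π₀ (∑ i, ‖h i‖ ^ 2) := by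
  set N := ∑ i, ‖h i‖ ^ 2 with hN
  have hN0 : 0 ≤ N := Finset.sum_nonneg fun i _ => by positivity
  have s1 := klDiv_add_mutualInfoOfLaw_vectorLaw h2 h
  have s2 := klDiv_add_mutualInfoOfLaw_vectorLaw h2 (fun _ : Fin 1 => (√N : ℂ))
  have e1 : ∑ _i : Fin 1, ‖(√N : ℂ)‖ ^ 2 = N := by
    simp [Complex.norm_real, Real.sq_sqrt hN0]
  rw [e1] at s2
  rw [← hN] at s1
  have hs : scalarDiv π₀ N + scalarInfo π₀ N =
      klDiv (vectorLaw π₀ h).snd (complexNoise ι) + mutualInfoOfLaw (vectorLaw π₀ h) :=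
    s2.trans s1.symm
  rcases hN0.eq_or_lt with h0 | hpos
  · rw [← h0, zero_mul, ENNReal.ofReal_zero, add_eq_zero] at s1
    rw [s1.1, s1.2, add_zero, add_eq_zero] at hs
    rw [s1.1, s1.2, hs.1, hs.2]
    exact ⟨rfl, rfl⟩
  -- The matched filter `hᴴ / ‖h‖`, a coisometry onto one coordinate that maps `h` to `√N`.
  · set M : Matrix (Fin 1) ι ℂ := Matrix.of fun _ i => star (h i) / (√N : ℂ) with hMdef
    have hMap : ∀ k i, M k i = star (h i) / (√N : ℂ) := fun _ _ => rfl
    have hq : (√N : ℂ) ≠ 0 := by simpa using (Real.sqrt_pos.2 hpos).ne'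
    have hqq : (√N : ℂ) * (√N : ℂ) = (N : ℂ) := by
      rw [← Complex.ofReal_mul, Real.mul_self_sqrt hN0]
    have hsum : ∑ i, star (h i) * h i = (N : ℂ) := by
      rw [hN]
      push_cast
      refine Finset.sum_congr rfl fun i _ => ?_
      exact Complex.conj_mul' _
    have hMh : M *ᵥ h = fun _ => (√N : ℂ) := by
      funext k
      simp only [Matrix.mulVec, dotProduct, hMap]
      simp_rw [div_mul_eq_mul_div]
      rw [← Finset.sum_div, hsum, ← hqq, mul_div_assoc, div_self hq, mul_one]
    have hM : M * Mᴴ = 1 := by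
      ext k l
      rw [Subsingleton.elim l k, Matrix.one_apply_eq, Matrix.mul_apply]
      simp only [Matrix.conjTranspose_apply, hMap, star_div₀, star_star]
      have hst : star (√N : ℂ) = (√N : ℂ) := Complex.conj_ofReal _
      simp_rw [hst, div_mul_div_comm]
      rw [← Finset.sum_div, hsum, hqq, div_self]
      exact_mod_cast hpos.ne'
    have l1 := klDiv_vectorLaw_mulVec_le (π₀ := π₀) h hM
    have l2 := mutualInfoOfLaw_vectorLaw_mulVec_le (π₀ := π₀) h hM
    rw [hMh] at l1 l2
    -- Filtering can only decrease divergence and information, yet their finite sum is unchanged; so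
    -- neither decreases.
    have hfin : klDiv (vectorLaw π₀ h).snd (complexNoise ι) + mutualInfoOfLaw (vectorLaw π₀ h) ≠ ∞ :=
      s1 ▸ ENNReal.ofReal_ne_top
    have l1' : scalarDiv π₀ N ≤ klDiv (vectorLaw π₀ h).snd (complexNoise ι) := l1
    have l2' : scalarInfo π₀ N ≤ mutualInfoOfLaw (vectorLaw π₀ h) := l2
    have f1 := ENNReal.add_ne_top.1 hfin
    have f2 := ENNReal.add_ne_top.1 (hs ▸ hfin)
    constructor
    · refine le_antisymm ?_ l1'
      refine (ENNReal.add_le_add_iff_right f1.2).1 ?_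
      rw [← hs]
      gcongr
    · refine le_antisymm ?_ l2'
      refine (ENNReal.add_le_add_iff_left f1.1).1 ?_
      rw [← hs]
      gcongr

theorem scalarDiv_add_scalarInfo (h2 : MemLp (fun v : ℂ => v) 2 π₀) {s : ℝ} (hs : 0 ≤ s) :
    scalarDiv π₀ s + scalarInfo π₀ s = ENNReal.ofReal (s * ∫ v, ‖v‖ ^ 2 ∂π₀) := by
  have := klDiv_add_mutualInfoOfLaw_vectorLaw h2 (fun _ : Fin 1 => (√s : ℂ))
  rwa [show ∑ _i : Fin 1, ‖(√s : ℂ)‖ ^ 2 = s by simp [Complex.norm_real, Real.sq_sqrt hs]] at this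

theorem scalarInfo_ne_top (h2 : MemLp (fun v : ℂ => v) 2 π₀) {s : ℝ} (hs : 0 ≤ s) :
    scalarInfo π₀ s ≠ ∞ :=
  (ENNReal.add_ne_top.1 (scalarDiv_add_scalarInfo h2 hs ▸ ENNReal.ofReal_ne_top)).2

theorem scalarDiv_ne_top (h2 : MemLp (fun v : ℂ => v) 2 π₀) {s : ℝ} (hs : 0 ≤ s) :
    scalarDiv π₀ s ≠ ∞ :=
  (ENNReal.add_ne_top.1 (scalarDiv_add_scalarInfo h2 hs ▸ ENNReal.ofReal_ne_top)).1

/-- The matrix that selects the coordinates `e i`. -/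
theorem selection_mul_conjTranspose {e : ι → κ} (he : Function.Injective e) :
    ((1 : Matrix κ κ ℂ).submatrix e id) * ((1 : Matrix κ κ ℂ).submatrix e id)ᴴ = 1 := by
  have h := Matrix.submatrix_mul_equiv (1 : Matrix κ κ ℂ) 1 e (Equiv.refl κ) e
  rw [Matrix.one_mul, Matrix.submatrix_one e he] at h
  rw [Matrix.conjTranspose_submatrix, Matrix.conjTranspose_one]
  exact h

theorem selection_mulVec (e : ι → κ) (y : κ → ℂ) :
    ((1 : Matrix κ κ ℂ).submatrix e id) *ᵥ y = y ∘ e := by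
  funext i
  simp [Matrix.mulVec, dotProduct, Matrix.one_apply]

/-- Split gain `t` into two looks of gains `s` and `t - s`, and discard the second. -/
theorem scalarInfo_mono (h2 : MemLp (fun v : ℂ => v) 2 π₀) {s t : ℝ} (hs : 0 ≤ s) (hst : s ≤ t) :
    scalarInfo π₀ s ≤ scalarInfo π₀ t := by
  have he : Function.Injective (fun _ : Fin 1 => (0 : Fin 2)) := fun a b _ => Subsingleton.elim a b
  have key := mutualInfoOfLaw_vectorLaw_mulVec_le (π₀ := π₀) ![(√s : ℂ), (√(t - s) : ℂ)]
    (selection_mul_conjTranspose he)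
  rw [selection_mulVec, (vectorLaw_eq_scalar h2 _).2, (vectorLaw_eq_scalar h2 _).2] at key
  simpa [Fin.sum_univ_two, Complex.norm_real, Real.sq_sqrt, hs, sub_nonneg.2 hst] using key

/-- `klDiv_add_klDiv_le_of_prod` carried over from `(ℂ × ℂ) × ℂ` to `Fin 3 → ℂ`; coordinate `0` is
the shared one. -/
theorem klDiv_pi_submodular (Q : Measure (Fin 3 → ℂ)) [IsProbabilityMeasure Q] :
    klDiv (Q.map (· ∘ ![0, 1])) (complexNoise (Fin 2)) +
        klDiv (Q.map (· ∘ ![0, 2])) (complexNoise (Fin 2)) ≤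
      klDiv Q (complexNoise (Fin 3)) +
        klDiv (Q.map (· ∘ fun _ : Fin 1 => (0 : Fin 3))) (complexNoise (Fin 1)) := by
  set C := complexGaussian 1 with hC
  have m1 : Measurable fun y : ℂ => fun _ : Fin 1 => y := by fun_prop
  have m1' : Measurable fun y : Fin 1 → ℂ => y 0 := by fun_prop
  have m2 : Measurable fun y : ℂ × ℂ => ![y.1, y.2] := by
    refine measurable_pi_lambda _ fun i => ?_
    fin_cases i <;> simp <;> fun_prop
  have m2' : Measurable fun y : Fin 2 → ℂ => (y 0, y 1) := by fun_prop
  have m3 : Measurable fun y : (ℂ × ℂ) × ℂ => ![y.1.1, y.1.2, y.2] := by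
    refine measurable_pi_lambda _ fun i => ?_
    fin_cases i <;> simp <;> fun_prop
  have m3' : Measurable fun y : Fin 3 → ℂ => ((y 0, y 1), y 2) := by fun_prop
  have n1 : complexNoise (Fin 1) = C.map fun y => fun _ : Fin 1 => y := by
    refine (Measure.pi_eq fun s hs => ?_)
    rw [Measure.map_apply m1 (MeasurableSet.univ_pi hs)]
    simp only [Finset.univ_unique, Finset.prod_singleton]
    congr 1
    ext y
    simp [Set.mem_pi]
  have n2 : complexNoise (Fin 2) = (C.prod C).map fun y => ![y.1, y.2] := by
    refine (Measure.pi_eq fun s hs => ?_)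
    rw [Measure.map_apply m2 (MeasurableSet.univ_pi hs), Fin.prod_univ_two, ← Measure.prod_prod]
    congr 1
    ext y
    simp [Set.mem_pi, Fin.forall_fin_two]
  have n3 : complexNoise (Fin 3) = ((C.prod C).prod C).map fun y => ![y.1.1, y.1.2, y.2] := by
    refine (Measure.pi_eq fun s hs => ?_)
    rw [Measure.map_apply m3 (MeasurableSet.univ_pi hs), Fin.prod_univ_three, ← Measure.prod_prod,
      ← Measure.prod_prod]
    congr 1
    ext y
    simp [Set.mem_pi, Fin.forall_fin_succ, and_assoc]
  set ρ := Q.map fun y : Fin 3 → ℂ => ((y 0, y 1), y 2) with hρ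
  have i1 : IsProbabilityMeasure ρ := Measure.isProbabilityMeasure_map m3'.aemeasurable
  have key := klDiv_add_klDiv_le_of_prod ρ (C.prod C) C
  have i2 : IsProbabilityMeasure (ρ.map fun t => (t.1.1, t.2)) :=
    Measure.isProbabilityMeasure_map (by fun_prop)
  rw [Measure.fst_prod] at key
  have k3 : klDiv Q (complexNoise (Fin 3)) = klDiv ρ ((C.prod C).prod C) := by
    rw [← klDiv_map_of_leftInverse ρ _ m3 m3' (fun y => rfl), ← n3, hρ, Measure.map_map m3 m3']
    congr 1
    convert Measure.map_id.symm
    funext y i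
    fin_cases i <;> rfl
  have k2 : klDiv (Q.map (· ∘ ![0, 1])) (complexNoise (Fin 2)) = klDiv ρ.fst (C.prod C) := by
    rw [← klDiv_map_of_leftInverse ρ.fst _ m2 m2' (fun y => rfl), ← n2, hρ, Measure.fst,
      Measure.map_map measurable_fst m3', Measure.map_map m2 (measurable_fst.comp m3')]
    congr 2
    funext y i
    fin_cases i <;> rfl
  have k2' : klDiv (Q.map (· ∘ ![0, 2])) (complexNoise (Fin 2)) =
      klDiv (ρ.map fun t => (t.1.1, t.2)) (C.prod C) := by
    rw [← klDiv_map_of_leftInverse (ρ.map fun t => (t.1.1, t.2)) _ m2 m2' (fun y => rfl), ← n2, hρ,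
      Measure.map_map (by fun_prop) m3', Measure.map_map m2 (by fun_prop)]
    congr 2
    funext y i
    fin_cases i <;> rfl
  have k1 : klDiv (Q.map (· ∘ fun _ : Fin 1 => (0 : Fin 3))) (complexNoise (Fin 1)) =
      klDiv ρ.fst.fst C := by
    rw [← klDiv_map_of_leftInverse ρ.fst.fst _ m1 m1' (fun y => rfl), ← n1, hρ, Measure.fst,
      Measure.fst, Measure.map_map measurable_fst m3',
      Measure.map_map measurable_fst (measurable_fst.comp m3'),
      Measure.map_map m1 (measurable_fst.comp (measurable_fst.comp m3'))]
    rfl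
  rw [k1, k2, k2', k3]
  exact key

theorem scalarDiv_submodular (h2 : MemLp (fun v : ℂ => v) 2 π₀) {s d : ℝ} (hs : 0 ≤ s)
    (hd : 0 ≤ d) :
    scalarDiv π₀ (s + d) + scalarDiv π₀ (s + d) ≤ scalarDiv π₀ (s + 2 * d) + scalarDiv π₀ s := by
  set h : Fin 3 → ℂ := ![(√s : ℂ), (√d : ℂ), (√d : ℂ)] with hh
  have key := klDiv_pi_submodular (vectorLaw π₀ h).snd
  -- Selecting coordinates is a coisometry, so each marginal is again a vector channel, with
  -- divergence determined by its total gain: `s + d` twice, and `s`.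
  have sel : ∀ {m : ℕ} (e : Fin m → Fin 3), Function.Injective e →
      klDiv ((vectorLaw π₀ h).snd.map (· ∘ e)) (complexNoise (Fin m)) =
        scalarDiv π₀ (∑ i, ‖h (e i)‖ ^ 2) := by
    intro m e he
    have hm := map_mulVec_vectorLaw (π₀ := π₀) h (selection_mul_conjTranspose he)
    simp_rw [selection_mulVec] at hm
    rw [hm, (vectorLaw_eq_scalar h2 _).1]
    rfl
  rw [sel _ (by decide), sel _ (by decide), sel _ (by decide), (vectorLaw_eq_scalar h2 _).1] at key
  have e3 : s + d + d = s + 2 * d := by ring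
  simpa [hh, Fin.sum_univ_succ, Complex.norm_real, Real.sq_sqrt, hs, hd, e3, ← add_assoc] using key

theorem exists_scalarInfo_le_affine (h2 : MemLp (fun v : ℂ => v) 2 π₀) {m : ℝ} (hm : 0 < m) :
    ∃ b c : ℝ≥0, ENNReal.ofReal (b + c * m) = scalarInfo π₀ m ∧
      ∀ t, 0 ≤ t → scalarInfo π₀ t ≤ ENNReal.ofReal (b + c * t) := by
  set f : ℝ → ℝ := fun s => (scalarInfo π₀ s).toReal with hf
  set τ := ∫ v, ‖v‖ ^ 2 ∂π₀ with hτ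
  have hτ0 : 0 ≤ τ := integral_nonneg fun v => by positivity
  have hmono : ∀ s t, 0 ≤ s → s ≤ t → f s ≤ f t := fun s t hs hst =>
    ENNReal.toReal_mono (scalarInfo_ne_top h2 (hs.trans hst)) (scalarInfo_mono h2 hs hst)
  have hsum : ∀ s, 0 ≤ s → (scalarDiv π₀ s).toReal + f s = s * τ := by
    intro s hs
    rw [hf, ← ENNReal.toReal_add (scalarDiv_ne_top h2 hs) (scalarInfo_ne_top h2 hs),
      scalarDiv_add_scalarInfo h2 hs, ENNReal.toReal_ofReal (by positivity)]
  have hinc : ∀ s d, 0 ≤ s → 0 ≤ d → f (s + 2 * d) + f s ≤ 2 * f (s + d) := by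
    intro s d hs hd
    have a1 := scalarDiv_ne_top h2 (s := s + 2 * d) (by positivity)
    have a2 := scalarDiv_ne_top h2 (s := s + d) (by positivity)
    have a3 := scalarDiv_ne_top h2 hs
    have h := ENNReal.toReal_mono (ENNReal.add_ne_top.2 ⟨a1, a3⟩) (scalarDiv_submodular h2 hs hd)
    rw [ENNReal.toReal_add a2 a2, ENNReal.toReal_add a1 a3] at h
    have e1 := hsum (s + 2 * d) (by positivity)
    have e2 := hsum (s + d) (by positivity)
    have e3 := hsum s hs
    linarith
  obtain ⟨c, hc⟩ := (concaveOn_of_monotone_of_antitone_increments hmono hinc).exists_supergradient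
    (m := m) (by rw [interior_Ici]; exact hm)
  -- Slope and intercept are nonnegative, by monotonicity and by evaluation at `0`. This allows the
  -- affine bound to be used in `ℝ≥0∞`.
  have hc0 : 0 ≤ c := by
    have h1 := hc (m + 1) (Set.mem_Ici.2 (by linarith))
    have h3 := hmono m (m + 1) hm.le (by linarith)
    linarith
  have hb0 : 0 ≤ f m - c * m := by
    have h1 := hc 0 (Set.mem_Ici.2 le_rfl)
    have h3 : 0 ≤ f 0 := ENNReal.toReal_nonneg
    linarith
  refine ⟨⟨f m - c * m, hb0⟩, ⟨c, hc0⟩, ?_, fun t ht => ?_⟩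
  · change ENNReal.ofReal (f m - c * m + c * m) = _
    rw [sub_add_cancel]
    exact ENNReal.ofReal_toReal (scalarInfo_ne_top h2 hm.le)
  · rw [← ENNReal.ofReal_toReal (scalarInfo_ne_top h2 ht)]
    refine ENNReal.ofReal_le_ofReal ?_
    change f t ≤ f m - c * m + c * t
    linarith [hc t ht]

/-- The matched filter bound on the mutual information of a linear channel with iid inputs. -/
theorem mutualInfoOfLaw_mulVec_le_sum_scalarInfo (h2 : MemLp (fun v : ℂ => v) 2 π₀) {n : ℕ}
    (H : Matrix (Fin n) (Fin n) ℂ) :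
    mutualInfoOfLaw (noisyLaw (Measure.pi fun _ => π₀) (fun v => H *ᵥ v) (complexNoise (Fin n))) ≤
      ∑ j, scalarInfo π₀ (∑ i, ‖H i j‖ ^ 2) := by
  have e : (fun v : Fin n → ℂ => H *ᵥ v) = fun v => ∑ j, fun i => H i j * v j := by
    funext v i
    simp [Matrix.mulVec, dotProduct, Finset.sum_apply]
  rw [e]
  refine (mutualInfoOfLaw_noisyLaw_sum_le (h := fun j (v : ℂ) i => H i j * v)
    fun j => by fun_prop).trans ?_
  refine Finset.sum_le_sum fun j _ => le_of_eq ?_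
  exact (vectorLaw_eq_scalar h2 fun i => H i j).2

end MatchedFilter

/-! ### The law of the signal -/

section EntryLaw

/-- The law of an entry of the signal: the product of a `𝒞𝒩(0, Px)` variable and an independent
Bernoulli-`q` variable. -/
noncomputable def entryLaw (q : I) (Px : ℝ≥0) : Measure ℂ :=
  ((complexGaussian Px).prod (bernoulliMeasure (1 : ℂ) 0 q)).map fun t => t.1 * t.2

variable (q : I) (Px : ℝ≥0)

instance : IsProbabilityMeasure (entryLaw q Px) :=
  Measure.isProbabilityMeasure_map (by fun_prop)

theorem memLp_entryLaw : MemLp (fun v : ℂ => v) 2 (entryLaw q Px) := by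
  rw [entryLaw, memLp_map_measure_iff (by fun_prop) (by fun_prop)]
  change MemLp (fun t : ℂ × ℂ => t.1 * t.2) 2 _
  rw [memLp_two_iff_integrable_sq_norm (by fun_prop)]
  simp_rw [norm_mul, mul_pow]
  exact ((memLp_complexGaussian Px).integrable_norm_pow (by simp)).mul_prod
    (integrable_bernoulliMeasure (1 : ℂ) 0 q fun b => ‖b‖ ^ 2)

theorem integral_entryLaw : ∫ v, v ∂entryLaw q Px = 0 := by
  rw [entryLaw, integral_map (by fun_prop) (by fun_prop),
    integral_prod_mul (fun x : ℂ => x) (fun b : ℂ => b), integral_complexGaussian, zero_mul]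

theorem integral_norm_sq_entryLaw : ∫ v, ‖v‖ ^ 2 ∂entryLaw q Px = q * Px := by
  rw [entryLaw, integral_map (by fun_prop) (by fun_prop)]
  simp_rw [norm_mul, mul_pow]
  rw [integral_prod_mul (fun x : ℂ => ‖x‖ ^ 2) (fun b : ℂ => ‖b‖ ^ 2),
    integral_norm_sq_complexGaussian, integral_bernoulliMeasure]
  simp [mul_comm]

theorem signal_eq_mul {n : ℕ} (x b : Fin n → ℂ) : signal x b = fun i => x i * b i := by
  funext i
  simp [signal, Matrix.mulVec_diagonal]

theorem measurable_signal {n : ℕ} :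
    Measurable fun t : (Fin n → ℂ) × (Fin n → ℂ) => signal t.1 t.2 := by
  simp_rw [signal_eq_mul]
  fun_prop

theorem map_signal (n : ℕ) :
    ((Measure.pi fun _ : Fin n => complexGaussian Px).prod
      (Measure.pi fun _ => bernoulliMeasure (1 : ℂ) 0 q)).map (fun t => signal t.1 t.2) =
      Measure.pi fun _ => entryLaw q Px := by
  have hm : ∀ _ : Fin n, AEMeasurable (fun t : ℂ × ℂ => t.1 * t.2)
      ((complexGaussian Px).prod (bernoulliMeasure (1 : ℂ) 0 q)) := fun _ => by fun_prop
  rw [← (measurePreserving_arrowProdEquivProdArrow ℂ ℂ (Fin n) (fun _ => complexGaussian Px)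
    (fun _ => bernoulliMeasure (1 : ℂ) 0 q)).map_eq,
    Measure.map_map measurable_signal (MeasurableEquiv.measurable _)]
  have h := Measure.pi_map_pi hm
  rw [show (Measure.pi fun _ : Fin n => entryLaw q Px) = _ from h.symm]
  congr 1
  funext v
  simp only [Function.comp_apply, signal_eq_mul]
  rfl

end EntryLaw

/-! ### Measurability and trace of the random matrices -/

section Matrices

variable {n : ℕ}

theorem measurable_matrix_apply (i j : Fin n) :
    Measurable fun M : Matrix (Fin n) (Fin n) ℂ => M i j :=
  (measurable_pi_apply j).comp (measurable_pi_apply (X := fun _ : Fin n => Fin n → ℂ) i)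

theorem measurable_matrix_iff {α : Type*} [MeasurableSpace α] {f : α → Matrix (Fin n) (Fin n) ℂ}
    (h : ∀ i j, Measurable fun t => f t i j) : Measurable f :=
  measurable_pi_lambda (X := fun _ : Fin n => Fin n → ℂ) f fun i =>
    measurable_pi_lambda _ fun j => h i j

theorem measurable_samplingMatrix : Measurable (samplingMatrix (n := n)) := by
  refine measurable_matrix_iff fun i j => ?_
  by_cases h : i = j
  · subst h
    simpa [samplingMatrix] using measurable_pi_apply i
  · simp [samplingMatrix, Matrix.diagonal_apply_ne _ h]

theorem measurable_mul_mulVec : Measurable fun t : (Matrix (Fin n) (Fin n) ℂ ×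
    Matrix (Fin n) (Fin n) ℂ) × (Fin n → ℂ) => (t.1.1 * t.1.2) *ᵥ t.2 := by
  have h := fun i j => measurable_matrix_apply (n := n) i j
  refine measurable_pi_lambda _ fun i => ?_
  simp only [Matrix.mulVec, dotProduct, Matrix.mul_apply]
  refine Finset.measurable_sum _ fun j _ => Measurable.mul ?_ (by fun_prop)
  refine Finset.measurable_sum _ fun k _ => Measurable.mul ?_ ?_
  · exact (h i k).comp (by fun_prop)
  · exact (h k j).comp (by fun_prop)

theorem gramMatrix_eq (a : Fin n → ℂ) (U : Matrix (Fin n) (Fin n) ℂ) :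
    gramMatrix a U = (samplingMatrix a * U)ᴴ * (samplingMatrix a * U) := by
  simp [gramMatrix, Matrix.conjTranspose_mul, Matrix.mul_assoc]

open scoped ComplexOrder in
theorem gramMatrix_eigenvalues_nonneg (a : Fin n → ℂ) (U : Matrix (Fin n) (Fin n) ℂ) (i : Fin n) :
    0 ≤ (gramMatrix_isHermitian a U).eigenvalues i := by
  have h : (gramMatrix a U).PosSemidef :=
    gramMatrix_eq a U ▸ Matrix.posSemidef_conjTranspose_mul_self _
  exact h.eigenvalues_nonneg i

/-- Both sides are `tr R`. This links the column gains of the matched filter to the spectrum. -/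
theorem sum_norm_sq_eq_sum_eigenvalues (a : Fin n → ℂ) (U : Matrix (Fin n) (Fin n) ℂ) :
    ∑ j, ∑ i, ‖(samplingMatrix a * U) i j‖ ^ 2 =
      ∑ i, (gramMatrix_isHermitian a U).eigenvalues i := by
  have h := congrArg Complex.re (gramMatrix_isHermitian a U).trace_eq_sum_eigenvalues
  rw [Complex.re_sum] at h
  refine Eq.trans ?_ h
  rw [gramMatrix_eq, Matrix.trace, Complex.re_sum]
  refine Finset.sum_congr rfl fun j _ => ?_
  rw [Matrix.diag_apply, Matrix.mul_apply, Complex.re_sum]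
  refine Finset.sum_congr rfl fun i _ => ?_
  rw [Matrix.conjTranspose_apply, ← Complex.normSq_eq_norm_sq, Complex.normSq_apply]
  simp

end Matrices

/-! ### Conditioning on the matrices -/

section Conditioning

variable {n : ℕ} {Ω : Type*} [MeasurableSpace Ω] {P : Measure Ω} [IsProbabilityMeasure P]
  {p q : I} {Px : ℝ≥0} {a x b z : Ω → Fin n → ℂ} {U : Ω → Matrix (Fin n) (Fin n) ℂ}

/-- The joint law of the signal and the observation, given the matrices. -/
noncomputable def channelKernel (n : ℕ) (q : I) (Px : ℝ≥0) :
    Kernel (Matrix (Fin n) (Fin n) ℂ × Matrix (Fin n) (Fin n) ℂ)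
      ((Fin n → ℂ) × (Fin n → ℂ)) :=
  (Kernel.id ×ₖ Kernel.const _
    ((Measure.pi fun _ : Fin n => entryLaw q Px).prod (complexNoise (Fin n)))).map
      fun t => (t.2.1, (t.1.1 * t.1.2) *ᵥ t.2.1 + t.2.2)

theorem measurable_snd_fst_add {α : Type*} [MeasurableSpace α] {g : α × (Fin n → ℂ) → Fin n → ℂ}
    (hg : Measurable g) :
    Measurable fun t : α × ((Fin n → ℂ) × (Fin n → ℂ)) => (t.2.1, g (t.1, t.2.1) + t.2.2) := by
  fun_prop

theorem measurable_comp_model {α β γ δ : Type*} [MeasurableSpace α] [MeasurableSpace β]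
    [MeasurableSpace γ] [MeasurableSpace δ] {f : α → β} {g : α × α → α}
    {k : (β × γ) × (α × α) → δ} (hf : Measurable f) (hg : Measurable g) (hk : Measurable k) :
    Measurable fun t : (α × γ) × α × α × α =>
      k ((f t.1.1, t.1.2), (g (t.2.1, t.2.2.1), t.2.2.2)) := by
  fun_prop

theorem measurable_channelMap : Measurable fun t : (Matrix (Fin n) (Fin n) ℂ ×
    Matrix (Fin n) (Fin n) ℂ) × ((Fin n → ℂ) × (Fin n → ℂ)) =>
      (t.2.1, (t.1.1 * t.1.2) *ᵥ t.2.1 + t.2.2) :=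
  measurable_snd_fst_add (g := fun t : (Matrix (Fin n) (Fin n) ℂ ×
    Matrix (Fin n) (Fin n) ℂ) × (Fin n → ℂ) => (t.1.1 * t.1.2) *ᵥ t.2) measurable_mul_mulVec

instance : IsMarkovKernel (channelKernel n q Px) := by
  unfold channelKernel
  exact Kernel.IsMarkovKernel.map _ measurable_channelMap

theorem channelKernel_apply (w : Matrix (Fin n) (Fin n) ℂ × Matrix (Fin n) (Fin n) ℂ) :
    channelKernel n q Px w = noisyLaw (Measure.pi fun _ => entryLaw q Px)
      (fun v => (w.1 * w.2) *ᵥ v) (complexNoise (Fin n)) := by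
  rw [channelKernel, Kernel.map_apply _ measurable_channelMap, Kernel.prod_apply, Kernel.id_apply,
    Kernel.const_apply, Measure.dirac_prod, Measure.map_map measurable_channelMap (by fun_prop),
    noisyLaw]
  rfl

/-- Freezing: as `T` is independent of `A`, conditioning amounts to fixing `A = a`, provided that
the law of `Ψ (a, T)` depends on `a` only through `Φ a`. -/
theorem condDistrib_ae_eq_of_map_eq {Ω α τ δ ε : Type*} [MeasurableSpace Ω] [MeasurableSpace α]
    [MeasurableSpace τ] [MeasurableSpace δ] [MeasurableSpace ε] [StandardBorelSpace ε] [Nonempty ε]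
    {P : Measure Ω} [IsProbabilityMeasure P] {A : Ω → α} {T : Ω → τ} {ν : Measure α} {ρ : Measure τ}
    [IsProbabilityMeasure ν] [IsProbabilityMeasure ρ] (hA : AEMeasurable A P)
    (hT : AEMeasurable T P) (hlaw : P.map (fun ω => (A ω, T ω)) = ν.prod ρ) {Φ : α → δ}
    (hΦ : Measurable Φ) {Ψ : α × τ → ε} (hΨ : Measurable Ψ) {κ : Kernel δ ε} [IsFiniteKernel κ]
    (hκ : ∀ a, κ (Φ a) = ρ.map fun t => Ψ (a, t)) :
    condDistrib (fun ω => Ψ (A ω, T ω)) (fun ω => Φ (A ω)) P =ᵐ[P.map fun ω => Φ (A ω)] κ := by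
  have hAT : AEMeasurable (fun ω => (A ω, T ω)) P := hA.prodMk hT
  have hY : AEMeasurable (fun ω => Ψ (A ω, T ω)) P := hΨ.comp_aemeasurable hAT
  have hW : AEMeasurable (fun ω => Φ (A ω)) P := hΦ.comp_aemeasurable hA
  have hmapA : P.map A = ν := by
    rw [← Measure.fst_prod (μ := ν) (ν := ρ), ← hlaw, Measure.fst_map_prodMk₀ hT]
  refine condDistrib_ae_eq_of_measure_eq_compProd _ hY (Measure.ext_of_lintegral _ fun f hf => ?_)
  have hf2 : Measurable fun t : α × τ => f (Φ t.1, Ψ t) := by fun_prop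
  have hg : Measurable fun w => ∫⁻ c, f (w, c) ∂κ w := by fun_prop
  rw [lintegral_map' hf.aemeasurable (hW.prodMk hY), Measure.lintegral_compProd hf,
    lintegral_map' hg.aemeasurable hW,
    ← lintegral_map' (f := fun t : α × τ => f (Φ t.1, Ψ t)) hf2.aemeasurable hAT, hlaw,
    lintegral_prod _ hf2.aemeasurable,
    ← lintegral_map' (f := fun a => ∫⁻ c, f (Φ a, c) ∂κ (Φ a)) (hg.comp hΦ).aemeasurable hA, hmapA]
  refine lintegral_congr fun a => ?_
  rw [hκ, lintegral_map (by fun_prop) (by fun_prop)]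

theorem map_prodAssoc_symm_prod {Ω α β γ : Type*} [MeasurableSpace Ω] [MeasurableSpace α]
    [MeasurableSpace β] [MeasurableSpace γ] {P : Measure Ω} {X : Ω → α} {Y : Ω → β} {T : Ω → γ}
    {μ : Measure α} {ν : Measure β} {ρ : Measure γ} [SFinite μ] [SFinite ν] [SFinite ρ]
    (hX : AEMeasurable X P) (hY : AEMeasurable Y P) (hT : AEMeasurable T P)
    (h : P.map (fun ω => (X ω, Y ω, T ω)) = μ.prod (ν.prod ρ)) :
    P.map (fun ω => ((X ω, Y ω), T ω)) = (μ.prod ν).prod ρ := by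
  have h2 := congrArg (Measure.map (MeasurableEquiv.prodAssoc (α := α) (β := β) (γ := γ)).symm) h
  rw [AEMeasurable.map_map_of_aemeasurable (MeasurableEquiv.measurable _).aemeasurable
    (hX.prodMk (hY.prodMk hT)), ← Measure.prodAssoc_prod, MeasurableEquiv.map_symm_map] at h2
  exact h2

theorem channelKernel_eq_map (w : Matrix (Fin n) (Fin n) ℂ × Matrix (Fin n) (Fin n) ℂ) :
    channelKernel n q Px w = ((Measure.pi fun _ => complexGaussian Px).prod
      ((Measure.pi fun _ => bernoulliMeasure (1 : ℂ) 0 q).prod (complexNoise (Fin n)))).map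
      fun t => (signal t.1 t.2.1, (w.1 * w.2) *ᵥ signal t.1 t.2.1 + t.2.2) := by
  have hm := measurable_mulVec (w.1 * w.2)
  have hs := measurable_signal (n := n)
  refine Measure.ext_of_lintegral _ fun f hf => ?_
  rw [channelKernel_apply, lintegral_noisyLaw hm hf, ← map_signal,
    lintegral_map (by fun_prop) hs, lintegral_map hf (by fun_prop),
    lintegral_prod _ (by fun_prop), lintegral_prod _ (by fun_prop)]
  refine lintegral_congr fun x' => ?_
  rw [lintegral_prod _ (by fun_prop)]

theorem IsObservationModel.condDistrib_ae_eq (h : IsObservationModel P p q Px a x b z U) :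
    condDistrib (fun ω => (signal (x ω) (b ω), observation (a ω) (U ω) (x ω) (b ω) (z ω)))
      (fun ω => (samplingMatrix (a ω), U ω)) P =ᵐ[P.map fun ω => (samplingMatrix (a ω), U ω)]
      channelKernel n q Px := by
  have hU := h.aemeasurable_U
  have hx := h.law_x.aemeasurable
  have hb := h.law_b.aemeasurable
  have hz := h.law_z.aemeasurable
  have ha := h.law_a.aemeasurable
  have i1 : IsProbabilityMeasure (P.map a) := Measure.isProbabilityMeasure_map ha
  have i2 : IsProbabilityMeasure (P.map U) := Measure.isProbabilityMeasure_map hU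
  have hlaw := h.indep
  rw [h.law_x.map_eq, h.law_b.map_eq, h.law_z.map_eq] at hlaw
  have hT : AEMeasurable (fun ω => (x ω, b ω, z ω)) P := hx.prodMk (hb.prodMk hz)
  exact condDistrib_ae_eq_of_map_eq (A := fun ω => (a ω, U ω)) (T := fun ω => (x ω, b ω, z ω))
    (ρ := (Measure.pi fun _ => complexGaussian Px).prod
      ((Measure.pi fun _ => bernoulliMeasure (1 : ℂ) 0 q).prod (complexNoise (Fin n))))
    (ha.prodMk hU) hT (map_prodAssoc_symm_prod ha hU hT hlaw)
    (Φ := fun t => (samplingMatrix t.1, t.2))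
    ((measurable_samplingMatrix.comp measurable_fst).prodMk measurable_snd)
    (Ψ := fun t => (signal t.2.1 t.2.2.1, observation t.1.1 t.1.2 t.2.1 t.2.2.1 t.2.2.2))
    (measurable_comp_model (k := fun t : (Matrix (Fin n) (Fin n) ℂ ×
      Matrix (Fin n) (Fin n) ℂ) × ((Fin n → ℂ) × (Fin n → ℂ)) =>
        (t.2.1, (t.1.1 * t.1.2) *ᵥ t.2.1 + t.2.2))
      (g := fun t : (Fin n → ℂ) × (Fin n → ℂ) => signal t.1 t.2)
      measurable_samplingMatrix measurable_signal measurable_channelMap)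
    fun _ => channelKernel_eq_map _

theorem IsObservationModel.condMutualInfo_le (h : IsObservationModel P p q Px a x b z U) :
    condMutualInfo (fun ω => signal (x ω) (b ω))
      (fun ω => observation (a ω) (U ω) (x ω) (b ω) (z ω))
      (fun ω => (samplingMatrix (a ω), U ω)) P ≤
    ∫⁻ ω, mutualInfoOfLaw (noisyLaw (Measure.pi fun _ => entryLaw q Px)
      (fun v => (samplingMatrix (a ω) * U ω) *ᵥ v) (complexNoise (Fin n))) ∂P := by
  rw [condMutualInfo]
  have e := h.condDistrib_ae_eq
  calc _ = ∫⁻ w, mutualInfoOfLaw (channelKernel n q Px w)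
        ∂(P.map fun ω => (samplingMatrix (a ω), U ω)) := by
        refine lintegral_congr_ae ?_
        filter_upwards [e] with w hw
        rw [hw]
    _ ≤ _ := by
        -- An upper bound suffices, and this direction needs no measurability of the mutual
        -- information as a function of the matrices.
        refine (lintegral_map_le _ _).trans (le_of_eq ?_)
        simp_rw [channelKernel_apply]

end Conditioning

/-! ### Passing to the limiting spectrum -/

section Limits

variable {Ω : ℕ → Type*} [∀ n, MeasurableSpace (Ω n)] {P : ∀ n, Measure (Ω n)}
  [∀ n, IsProbabilityMeasure (P n)] {a : ∀ n, Ω n → Fin n → ℂ}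
  {U : ∀ n, Ω n → Matrix (Fin n) (Fin n) ℂ} {μ : Measure ℝ}

theorem IsLimitingSpectrum.ae_nonneg (hμ : IsLimitingSpectrum P a U μ) : ∀ᵐ t ∂μ, 0 ≤ t := by
  -- A bounded test function positive exactly on the negative half-line, where `R` has no
  -- eigenvalues.
  let f : ℝ →ᵇ ℝ≥0 := BoundedContinuousFunction.mkOfBound
    ⟨fun t => min (-t).toNNReal 1, by fun_prop⟩ 1 fun s t => by
      rw [NNReal.dist_eq, abs_le]
      have h1 : ∀ r : ℝ≥0, ((min r 1 : ℝ≥0) : ℝ) ≤ 1 := fun r => by exact_mod_cast min_le_right r 1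
      have h2 : ∀ r : ℝ≥0, (0 : ℝ) ≤ (min r 1 : ℝ≥0) := fun r => NNReal.coe_nonneg _
      have := h1 (-s).toNNReal
      have := h1 (-t).toNNReal
      have := h2 (-s).toNNReal
      have := h2 (-t).toNNReal
      constructor <;> simp only [ContinuousMap.coe_mk] <;> linarith
  have hf : ∀ t : ℝ, f t = min (-t).toNNReal 1 := fun t => rfl
  have h0 : ∀ n, expectedSpectralStat (P n) (a n) (U n) (fun t => (f t : ℝ≥0∞)) = 0 := by
    intro n
    rw [expectedSpectralStat]
    have : ∀ ω, (∑ i, (f ((gramMatrix_isHermitian (a n ω) (U n ω)).eigenvalues i) : ℝ≥0∞)) / n =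
        0 := by
      intro ω
      rw [Finset.sum_eq_zero, ENNReal.zero_div]
      intro i _
      rw [hf, Real.toNNReal_of_nonpos (by linarith [gramMatrix_eigenvalues_nonneg (a n ω) (U n ω) i])]
      simp
    simp [this]
  have hlim := hμ.weak f
  simp_rw [h0] at hlim
  have hz : ∫⁻ t, f t ∂μ = 0 := tendsto_nhds_unique hlim tendsto_const_nhds
  rw [lintegral_eq_zero_iff (by fun_prop)] at hz
  filter_upwards [hz] with t ht
  simp only [hf, Pi.zero_apply, ENNReal.coe_eq_zero] at ht
  by_contra hneg
  have h1 : 0 < (-t).toNNReal := Real.toNNReal_pos.2 (by linarith)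
  exact (lt_min h1 one_pos).ne' ht

theorem limsup_expectedSpectralStat_log_le (hμ : IsLimitingSpectrum P a U μ) {s : ℝ} (hs : 0 ≤ s) :
    limsup (fun n => expectedSpectralStat (P n) (a n) (U n)
      fun t => ENNReal.ofReal (Real.log (1 + s * t))) atTop ≤
      ENNReal.ofReal (shannonTransform μ s) := by
  have hprob := hμ.isProbabilityMeasure
  -- The deficit of `log (1 + s t)` below its tangent `s t` at the origin, extended by its value at
  -- `0` to negative `t` so as to be continuous on the line.
  set g : ℝ → ℝ := fun t => s * max t 0 - Real.log (1 + s * max t 0) with hg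
  have hgc : Continuous g := by
    refine (by fun_prop : Continuous fun t : ℝ => s * max t 0).sub
      (Continuous.log (by fun_prop) fun t => ?_)
    have : 0 ≤ s * max t 0 := mul_nonneg hs (le_max_right _ _)
    positivity
  have hlog0 : ∀ t : ℝ, 0 ≤ Real.log (1 + s * max t 0) := fun t =>
    Real.log_nonneg (by have : 0 ≤ s * max t 0 := mul_nonneg hs (le_max_right _ _); linarith)
  have hg0 : ∀ t, 0 ≤ g t := fun t => by
    have h1 : 0 ≤ s * max t 0 := mul_nonneg hs (le_max_right _ _)
    have := Real.log_le_sub_one_of_pos (by positivity : 0 < 1 + s * max t 0)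
    rw [hg]
    linarith
  let f : ℕ → ℝ →ᵇ ℝ≥0 := fun M => BoundedContinuousFunction.mkOfBound
    ⟨fun t => min (g t).toNNReal M, by fun_prop⟩ M fun s t => by
      rw [NNReal.dist_eq, abs_le]
      have h1 : ∀ r : ℝ≥0, ((min r M : ℝ≥0) : ℝ) ≤ M := fun r => by
        have := min_le_right r (M : ℝ≥0)
        exact_mod_cast this
      have h2 : ∀ r : ℝ≥0, (0 : ℝ) ≤ (min r M : ℝ≥0) := fun r => NNReal.coe_nonneg _
      have := h1 (g s).toNNReal
      have := h1 (g t).toNNReal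
      have := h2 (g s).toNNReal
      have := h2 (g t).toNNReal
      constructor <;> simp only [ContinuousMap.coe_mk] <;> linarith
  have hf : ∀ M t, f M t = min (g t).toNNReal M := fun M t => rfl
  have hpt : ∀ M t, 0 ≤ t → ENNReal.ofReal (Real.log (1 + s * t)) + f M t ≤
      ENNReal.ofReal s * ENNReal.ofReal t := by
    intro M t ht
    have h1 : ((f M t : ℝ≥0) : ℝ≥0∞) ≤ ENNReal.ofReal (g t) := by
      rw [hf, ENNReal.ofReal]
      exact_mod_cast min_le_left _ _
    have h2 := hlog0 t
    rw [max_eq_left ht] at h2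
    refine (add_le_add le_rfl h1).trans ?_
    rw [← ENNReal.ofReal_add h2 (hg0 t), ← ENNReal.ofReal_mul hs]
    refine ENNReal.ofReal_le_ofReal ?_
    simp only [hg, max_eq_left ht]
    linarith
  have hstat : ∀ M n, expectedSpectralStat (P n) (a n) (U n)
        (fun t => ENNReal.ofReal (Real.log (1 + s * t))) +
      expectedSpectralStat (P n) (a n) (U n) (fun t => (f M t : ℝ≥0∞)) ≤
      ENNReal.ofReal s * expectedSpectralStat (P n) (a n) (U n) ENNReal.ofReal := by
    intro M n
    rw [expectedSpectralStat, expectedSpectralStat, expectedSpectralStat,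
      ← lintegral_const_mul' _ _ ENNReal.ofReal_ne_top]
    -- Superadditivity of the lower integral holds without measurability of the eigenvalues.
    refine (le_lintegral_add _ _).trans (lintegral_mono fun ω => ?_)
    simp only
    rw [← ENNReal.add_div, ← Finset.sum_add_distrib, ← mul_div_assoc, Finset.mul_sum]
    gcongr with i
    exact hpt M _ (gramMatrix_eigenvalues_nonneg _ _ _)
  set m := ∫ t, t ∂μ with hm
  have hnn := hμ.ae_nonneg
  have hbound : ∀ M, limsup (fun n => expectedSpectralStat (P n) (a n) (U n)
      fun t => ENNReal.ofReal (Real.log (1 + s * t))) atTop ≤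
      ENNReal.ofReal s * ENNReal.ofReal m - ∫⁻ t, f M t ∂μ := by
    intro M
    have hfin : ∫⁻ t, f M t ∂μ ≠ ∞ := by
      refine ne_top_of_le_ne_top (b := ∫⁻ _, (M : ℝ≥0∞) ∂μ) (by simp) (lintegral_mono fun t => ?_)
      rw [hf]
      refine (ENNReal.coe_le_coe.2 (min_le_right _ _)).trans (le_of_eq ?_)
      simp
    have hT : Tendsto (fun n => ENNReal.ofReal s * expectedSpectralStat (P n) (a n) (U n)
        ENNReal.ofReal - expectedSpectralStat (P n) (a n) (U n) (fun t => (f M t : ℝ≥0∞))) atTop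
        (𝓝 (ENNReal.ofReal s * ENNReal.ofReal m - ∫⁻ t, f M t ∂μ)) :=
      ENNReal.Tendsto.sub (ENNReal.Tendsto.const_mul hμ.mean (Or.inr ENNReal.ofReal_ne_top))
        (hμ.weak (f M)) (Or.inr hfin)
    rw [← hT.limsup_eq]
    refine limsup_le_limsup ?_
    filter_upwards [(hμ.weak (f M)).eventually_ne hfin] with n hn
    exact ENNReal.le_sub_of_add_le_right hn (hstat M n)
  have hgi : Integrable g μ := by
    refine Integrable.mono' (hμ.integrable.abs.const_mul s) hgc.aestronglyMeasurable
      (ae_of_all _ fun t => ?_)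
    rw [Real.norm_of_nonneg (hg0 t), hg]
    have h1 : max t 0 ≤ |t| := max_le (le_abs_self t) (abs_nonneg t)
    have := hlog0 t
    have h3 := mul_le_mul_of_nonneg_left h1 hs
    simp only
    linarith
  -- Removing the truncation by monotone convergence recovers the full deficit, and `s E[t] - E[g]`
  -- is the Shannon transform.
  have hmono : Tendsto (fun M : ℕ => ∫⁻ t, f M t ∂μ) atTop (𝓝 (∫⁻ t, ENNReal.ofReal (g t) ∂μ)) := by
    refine lintegral_tendsto_of_tendsto_of_monotone (fun M => by fun_prop)
      (ae_of_all _ fun t => ?_) (ae_of_all _ fun t => ?_)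
    · intro M N hMN
      simp only [hf]
      have : (M : ℝ≥0) ≤ N := by exact_mod_cast hMN
      exact_mod_cast min_le_min_left _ this
    · refine tendsto_const_nhds.congr' ?_
      obtain ⟨N, hN⟩ := exists_nat_ge (g t).toNNReal
      filter_upwards [eventually_ge_atTop N] with M hM
      have : (N : ℝ≥0) ≤ M := by exact_mod_cast hM
      rw [hf, min_eq_left (hN.trans this)]
      rfl
  rw [← ofReal_integral_eq_lintegral_ofReal hgi (ae_of_all _ hg0)] at hmono
  have hlim := ENNReal.Tendsto.sub (tendsto_const_nhds
    (x := ENNReal.ofReal s * ENNReal.ofReal m)) hmono (Or.inr ENNReal.ofReal_ne_top)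
  refine (ge_of_tendsto' hlim hbound).trans (le_of_eq ?_)
  rw [← ENNReal.ofReal_mul hs, ← ENNReal.ofReal_sub _ (integral_nonneg hg0), shannonTransform, hm,
    ← integral_const_mul, ← integral_sub (hμ.integrable.const_mul s) hgi]
  congr 1
  refine integral_congr_ae ?_
  filter_upwards [hnn] with t ht
  simp only [hg, max_eq_left ht]
  ring

end Limits

/-! ### The scalar channel of the statement -/

section ScalarChannel

/-- The scalar Gaussian channel with real gain. -/
theorem scalarInfo_le_mutualInfo {q : I} {Px : ℝ≥0} {Ω₀ : Type*} [MeasurableSpace Ω₀]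
    {P₀ : Measure Ω₀} [IsProbabilityMeasure P₀] {B₀ X₀ Z : Ω₀ → ℂ}
    (hB₀ : HasLaw B₀ (bernoulliMeasure (1 : ℂ) 0 q) P₀) (hX₀ : HasLaw X₀ (complexGaussian Px) P₀)
    (hZ : HasLaw Z (complexGaussian 1) P₀) (hindep : iIndepFun ![B₀, X₀, Z] P₀) (m : ℝ) :
    scalarInfo (entryLaw q Px) m ≤ mutualInfo (fun ω => X₀ ω * B₀ ω)
      (fun ω => (√m : ℂ) * (X₀ ω * B₀ ω) + Z ω) P₀ := by
  have hBm := hB₀.aemeasurable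
  have hXm := hX₀.aemeasurable
  have hZm := hZ.aemeasurable
  have hmeas : ∀ i, AEMeasurable (![B₀, X₀, Z] i) P₀ := by
    intro i
    fin_cases i <;> assumption
  have hXB : IndepFun X₀ B₀ P₀ := hindep.indepFun (i := 1) (j := 0) (by decide)
  have hVZ : IndepFun (fun ω => X₀ ω * B₀ ω) Z P₀ :=
    hindep.indepFun_mul_left₀ hmeas 1 0 2 (by decide) (by decide)
  have hVlaw : P₀.map (fun ω => X₀ ω * B₀ ω) = entryLaw q Px := by
    have h := (indepFun_iff_map_prod_eq_prod_map_map hXm hBm).1 hXB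
    rw [hX₀.map_eq, hB₀.map_eq] at h
    rw [entryLaw, ← h, AEMeasurable.map_map_of_aemeasurable (by fun_prop) (by fun_prop)]
    rfl
  have hV : AEMeasurable (fun ω => X₀ ω * B₀ ω) P₀ := by fun_prop
  have hjoint := (indepFun_iff_map_prod_eq_prod_map_map hV hZm).1 hVZ
  rw [hVlaw, hZ.map_eq] at hjoint
  have hg : Measurable fun v : ℂ => (√m : ℂ) * v := by fun_prop
  have hlaw : P₀.map (fun ω => (X₀ ω * B₀ ω, (√m : ℂ) * (X₀ ω * B₀ ω) + Z ω)) =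
      noisyLaw (entryLaw q Px) (fun v : ℂ => (√m : ℂ) * v) (complexGaussian 1) := by
    rw [noisyLaw, ← hjoint, AEMeasurable.map_map_of_aemeasurable (by fun_prop) (by fun_prop)]
    rfl
  have hnoise : (complexGaussian 1).map (fun y => fun _ : Fin 1 => y) = complexNoise (Fin 1) := by
    refine (Measure.pi_eq fun s hs => ?_).symm
    rw [Measure.map_apply (by fun_prop) (MeasurableSet.univ_pi hs)]
    simp only [Finset.univ_unique, Finset.prod_singleton]
    congr 1
    ext y
    simp [Set.mem_pi]
  let c : ℂ →+ (Fin 1 → ℂ) := AddMonoidHom.mk' (fun y _ => y) fun _ _ => rfl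
  have key := mutualInfoOfLaw_noisyLaw_output_le (π := entryLaw q Px) (ν := complexGaussian 1) c
    (by fun_prop : Measurable fun (y : ℂ) (_ : Fin 1) => y) hg
  rw [mutualInfo, hlaw]
  refine le_trans (le_of_eq ?_) key
  rw [scalarInfo, vectorLaw, ← hnoise]
  rfl

end ScalarChannel

end SupportRecovery

/-! ### The two bounds -/

open SupportRecovery in
theorem theorem3 {Ω : ℕ → Type*} [∀ n, MeasurableSpace (Ω n)]
    (P : ∀ n, Measure (Ω n)) [∀ n, IsProbabilityMeasure (P n)]
    (p q : unitInterval) (Px : ℝ≥0)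
    (a x b z : ∀ n, Ω n → Fin n → ℂ) (U : ∀ n, Ω n → Matrix (Fin n) (Fin n) ℂ)
    (hmodel : ∀ n, SupportRecovery.IsObservationModel (P n) p q Px (a n) (x n) (b n) (z n) (U n))
    (μ : Measure ℝ) (hμ : SupportRecovery.IsLimitingSpectrum P a U μ)
    {Ω₀ : Type*} [MeasurableSpace Ω₀] (P₀ : Measure Ω₀) [IsProbabilityMeasure P₀]
    (B₀ X₀ Z : Ω₀ → ℂ)
    (hB₀ : HasLaw B₀ (bernoulliMeasure (1 : ℂ) 0 q) P₀)
    (hX₀ : HasLaw X₀ (SupportRecovery.complexGaussian Px) P₀)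
    (hZ : HasLaw Z (SupportRecovery.complexGaussian 1) P₀)
    (hindep : iIndepFun ![B₀, X₀, Z] P₀) :
    limsup (fun n : ℕ => SupportRecovery.condMutualInfo
        (fun ω => SupportRecovery.signal (x n ω) (b n ω))
        (fun ω => SupportRecovery.observation (a n ω) (U n ω) (x n ω) (b n ω) (z n ω))
        (fun ω => (SupportRecovery.samplingMatrix (a n ω), U n ω)) (P n) / (n : ℝ≥0∞)) atTop
      ≤ ENNReal.ofReal (SupportRecovery.shannonTransform μ ((q : ℝ) * (Px : ℝ))) ∧
    limsup (fun n : ℕ => SupportRecovery.condMutualInfo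
        (fun ω => SupportRecovery.signal (x n ω) (b n ω))
        (fun ω => SupportRecovery.observation (a n ω) (U n ω) (x n ω) (b n ω) (z n ω))
        (fun ω => (SupportRecovery.samplingMatrix (a n ω), U n ω)) (P n) / (n : ℝ≥0∞)) atTop
      ≤ SupportRecovery.mutualInfo (fun ω => X₀ ω * B₀ ω)
          (fun ω => (Real.sqrt (∫ t, t ∂μ) : ℂ) * (X₀ ω * B₀ ω) + Z ω) P₀ := by
  have hprob := hμ.isProbabilityMeasure
  have h2 := memLp_entryLaw q Px
  have hs0 : (0 : ℝ) ≤ q * Px := mul_nonneg q.2.1 Px.2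
  have hdiv : ∀ n : ℕ, n ≠ 0 → ∀ F : Ω n → ℝ≥0∞,
      (∀ ω, mutualInfoOfLaw (noisyLaw (Measure.pi fun _ => entryLaw q Px)
        (fun v => (samplingMatrix (a n ω) * U n ω) *ᵥ v) (complexNoise (Fin n))) ≤ F ω) →
      condMutualInfo (fun ω => signal (x n ω) (b n ω))
        (fun ω => observation (a n ω) (U n ω) (x n ω) (b n ω) (z n ω))
        (fun ω => (samplingMatrix (a n ω), U n ω)) (P n) / (n : ℝ≥0∞) ≤
        ∫⁻ ω, F ω / n ∂(P n) := by
    intro n hn F hF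
    simp_rw [ENNReal.div_eq_inv_mul]
    rw [lintegral_const_mul' _ _ (by simpa using hn)]
    gcongr
    exact (hmodel n).condMutualInfo_le.trans (lintegral_mono hF)
  have hfirst : limsup (fun n : ℕ => condMutualInfo (fun ω => signal (x n ω) (b n ω))
        (fun ω => observation (a n ω) (U n ω) (x n ω) (b n ω) (z n ω))
        (fun ω => (samplingMatrix (a n ω), U n ω)) (P n) / (n : ℝ≥0∞)) atTop
      ≤ ENNReal.ofReal (shannonTransform μ ((q : ℝ) * (Px : ℝ))) := by
    refine (limsup_le_limsup ?_).trans (limsup_expectedSpectralStat_log_le hμ hs0)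
    filter_upwards [eventually_ne_atTop 0] with n hn
    refine hdiv n hn _ fun ω => ?_
    have key := mutualInfoOfLaw_mulVec_le_sum_log h2 (integral_entryLaw q Px)
      (samplingMatrix (a n ω) * U n ω) (gramMatrix_isHermitian (a n ω) (U n ω))
      (gramMatrix_eq (a n ω) (U n ω))
    rw [integral_norm_sq_entryLaw, ENNReal.ofReal_sum_of_nonneg] at key
    · exact key
    · intro i _
      have := gramMatrix_eigenvalues_nonneg (a n ω) (U n ω) i
      exact Real.log_nonneg (by nlinarith [mul_nonneg hs0 this])
  refine ⟨hfirst, ?_⟩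
  refine le_trans ?_ (scalarInfo_le_mutualInfo hB₀ hX₀ hZ hindep (∫ t, t ∂μ))
  have hnn := hμ.ae_nonneg
  -- A spectrum of mean zero is concentrated at `0`, a boundary point at which the supergradient
  -- lemma does not apply. There the Shannon transform vanishes and the first bound suffices.
  rcases (integral_nonneg_of_ae hnn).eq_or_lt with hm | hm
  · refine hfirst.trans ?_
    have hz := (integral_eq_zero_iff_of_nonneg_ae hnn hμ.integrable).1 hm.symm
    have : shannonTransform μ ((q : ℝ) * (Px : ℝ)) = 0 := by
      rw [shannonTransform]
      refine integral_eq_zero_of_ae ?_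
      filter_upwards [hz] with t ht
      simp only [Pi.zero_apply] at ht ⊢
      simp [ht]
    simp [this]
  · obtain ⟨β, c, hc, hle⟩ := exists_scalarInfo_le_affine h2 hm
    have hT : Tendsto (fun n => (β : ℝ≥0∞) +
        c * expectedSpectralStat (P n) (a n) (U n) ENNReal.ofReal) atTop
        (𝓝 (β + c * ENNReal.ofReal (∫ t, t ∂μ))) :=
      tendsto_const_nhds.add (ENNReal.Tendsto.const_mul hμ.mean (Or.inr ENNReal.coe_ne_top))
    have hval : (β : ℝ≥0∞) + c * ENNReal.ofReal (∫ t, t ∂μ) =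
        scalarInfo (entryLaw q Px) (∫ t, t ∂μ) := by
      rw [← hc, ENNReal.ofReal_add β.coe_nonneg (by positivity), ENNReal.ofReal_mul c.coe_nonneg,
        ENNReal.ofReal_coe_nnreal, ENNReal.ofReal_coe_nnreal]
    rw [← hval, ← hT.limsup_eq]
    refine limsup_le_limsup ?_
    filter_upwards [eventually_ne_atTop 0] with n hn
    have hn0 : (n : ℝ≥0∞) ≠ 0 := by exact_mod_cast hn
    -- Summing the affine bound over the `n` columns gives `n β + c tr R`. Divided by `n`, its
    -- expectation is the convergent sequence of `hT`.
    refine (hdiv n hn (fun ω => n * β + c * ∑ i, ENNReal.ofReal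
      ((gramMatrix_isHermitian (a n ω) (U n ω)).eigenvalues i)) fun ω => ?_).trans ?_
    · refine (mutualInfoOfLaw_mulVec_le_sum_scalarInfo h2 _).trans ?_
      have hN : ∀ j, 0 ≤ ∑ i, ‖(samplingMatrix (a n ω) * U n ω) i j‖ ^ 2 := fun j =>
        Finset.sum_nonneg fun i _ => by positivity
      refine (Finset.sum_le_sum fun j _ => hle _ (hN j)).trans (le_of_eq ?_)
      have e : ∀ j, ENNReal.ofReal (β + c * ∑ i, ‖(samplingMatrix (a n ω) * U n ω) i j‖ ^ 2) =
          β + c * ENNReal.ofReal (∑ i, ‖(samplingMatrix (a n ω) * U n ω) i j‖ ^ 2) := by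
        intro j
        rw [ENNReal.ofReal_add β.coe_nonneg (mul_nonneg c.coe_nonneg (hN j)),
          ENNReal.ofReal_mul c.coe_nonneg,
          ENNReal.ofReal_coe_nnreal, ENNReal.ofReal_coe_nnreal]
      simp_rw [e]
      rw [Finset.sum_add_distrib, ← Finset.mul_sum, ← ENNReal.ofReal_sum_of_nonneg fun j _ => hN j,
        sum_norm_sq_eq_sum_eigenvalues, ENNReal.ofReal_sum_of_nonneg fun i _ =>
          gramMatrix_eigenvalues_nonneg _ _ i]
      simp
    · simp_rw [ENNReal.add_div, mul_div_assoc]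
      rw [lintegral_add_left measurable_const, lintegral_const_mul' _ _ ENNReal.coe_ne_top,
        lintegral_const, measure_univ, mul_one, ← mul_div_assoc,
        ENNReal.mul_div_right_comm, ENNReal.div_self hn0 (ENNReal.natCast_ne_top n), one_mul]
      rfl
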